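/- **Setting.** A supervised RBM with $n$ visible units, $n_2$ hidden units and a label is a joint law of $X\in\{\pm1\}^{n}$, $H\in\{\pm1\}^{n_2}$, $Y\in\{\pm1\}$ of the form $$\Pr[X=x,H=h,Y=y]\propto\exp\big(\langle x,Wh\rangle+\langle h,w\rangle y+\langle b^{(1)},x\rangle+\langle b^{(2)},h\rangle+b^{(3)}y\big),$$ with $W\in\mathbb R^{n\times n_2}$, $w,b^{(2)}\in\mathbb R^{n_2}$, $b^{(1)}\in\mathbb R^{n}$, $b^{(3)}\in\mathbb R$. Let $\alpha,\beta>0$ and $\lambda\in\mathbb R$, and assume: 1. (ferromagnetic) for all $i,j$, either $W_{ij}=0$ or $W_{ij}\ge\alpha$; 2. (conditional sparsity) $\sum_j W_{ij}+|b^{(1)}_i|\le\lambda$ for all $i$, and there is $y\in\{\pm1\}$ such that $\sum_i W_{ij}+|b^{(2)}_j+yw_j|\le\lambda$ for all $j$; 3. (balanced label) $\Pr[Y=y]\ge\beta$ for both $y\in\{\pm1\}$. The two-hop neighborhood $\mathcal N(u)$ of a visible unit $u$ is the set of visible units $v\ne u$ for which there is a hidden unit $j$ with $W_{uj}\ne0$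 and $W_{vj}\ne0$. **Algorithm.** Given $m$ samples $\mathcal S$ of $(X,Y)$, let $$\widehat{\mathsf{Cov}}^{\mathsf{Avg}}_{\mathcal S}(u,v\mid S,Y)=\sum_{x_S,y}\widehat{\Pr}[X_S=x_S,Y=y]\;\widehat{\mathsf{Cov}}(X_u,X_v\mid X_S=x_S,Y=y)$$ be the average conditional covariance under the empirical distribution. $\textsc{LearnSupervisedRBMNbhd}(u,\tau,\mathcal S)$ starts with $S=\emptyset$. As long as $\max_{v\ne u}\widehat{\mathsf{Cov}}^{\mathsf{Avg}}_{\mathcal S}(u,v\mid S,Y)\ge\tau$, it adds a maximizer $v$ to $S$. Then it visits every $v$ in the resulting set once, and removes $v$ from the current set $S$ if $\widehat{\mathsf{Cov}}^{\mathsf{Avg}}_{\mathcal S}(u,v\mid S\setminus\{v\},Y)<\tau$. It returns $S$. **Theorem.** There are absolute constants $C,c>0$ such that the following holds for every supervised RBM satisfying 1–3, every visible unit $u$ and every $\zeta\in(0,1)$. Put $$\tau=\tfrac{\beta\alpha^2}{2}e^{-12\lambda},\qquad \delta=\tfrac12e^{-2\lambda},\qquad T^*=\frac{8}{\tau^2},$$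 and let $\mathcal S$ consist of $m$ independent samples of $(X,Y)$, where $$m\ \ge\ C\,\big(\log(1/\zeta)+T^*\log n\big)\,\frac{2^{2T^*}}{\tau^2\,\beta\,\delta^{2T^*}} .$$ Then with probability at least $1-\zeta$, $\textsc{LearnSupervisedRBMNbhd}(u,\tau,\mathcal S)$ outputs exactly $\mathcal N(u)$, however ties between maximizers are broken and in whatever order the elements are visited in the pruning phase. Moreover, the algorithm runs in time $O(T^*mn)$: it has an explicit implementation which, on every sequence of $m$ samples, uses at most $c\,\max(1,T^*)\,m\,n$ elementary operations, each of which (exact real arithmetic, comparison, look-up of a spin, list operation) has unit cost. (If $W_{uj}\neq0$ for some $u,j$, then $\alpha\le\lambda$ and so $T^*\ge1$.) -/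

import Mathlib

noncomputable section

/-- The spin value `±1` encoded by a Boolean: `true` is `+1` and `false` is `-1`. -/
def spin (b : Bool) : ℝ := if b then 1 else -1

/-- The vector in `{±1}ⁿ` encoded by a Boolean vector. -/
def spins {n : ℕ} (x : Fin n → Bool) : Fin n → ℝ := fun i => spin (x i)

/-- The parameters of a supervised RBM with `n₁` visible units, `n₂` hidden units and a label. -/
structure SupervisedRBM (n₁ n₂ : ℕ) where
  /-- interactions between visible and hidden units -/
  W : Matrix (Fin n₁) (Fin n₂) ℝ
  /-- interactions between the label and the hidden units -/
  w : Fin n₂ → ℝ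
  /-- external field of the visible units -/
  b₁ : Fin n₁ → ℝ
  /-- external field of the hidden units -/
  b₂ : Fin n₂ → ℝ
  /-- external field of the label -/
  b₃ : ℝ

/-- An observation `(x, y)`: the visible units and the label, without the hidden units. -/
abbrev Sample (n : ℕ) := (Fin n → Bool) × Bool

namespace SupervisedRBM

variable {n₁ n₂ : ℕ}

/-- A joint state `(x, h, y)` of the visible units, the hidden units and the label. -/
abbrev Config (n₁ n₂ : ℕ) := (Fin n₁ → Bool) × (Fin n₂ → Bool) × Bool

/-- The exponent `⟨x, W h⟩ + ⟨h, w⟩ y + ⟨b₁, x⟩ + ⟨b₂, h⟩ + b₃ y`. -/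
def exponent (R : SupervisedRBM n₁ n₂) (c : Config n₁ n₂) : ℝ :=
  spins c.1 ⬝ᵥ (R.W.mulVec (spins c.2.1)) + (spins c.2.1 ⬝ᵥ R.w) * spin c.2.2
    + R.b₁ ⬝ᵥ spins c.1 + R.b₂ ⬝ᵥ spins c.2.1 + R.b₃ * spin c.2.2

/-- `Pr[X = x, H = h, Y = y]`. -/
def prob (R : SupervisedRBM n₁ n₂) (c : Config n₁ n₂) : ℝ :=
  Real.exp (R.exponent c) / ∑ c' : Config n₁ n₂, Real.exp (R.exponent c')

theorem prob_nonneg (R : SupervisedRBM n₁ n₂) (c : Config n₁ n₂) : 0 ≤ R.prob c := by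
  unfold prob
  positivity

theorem sum_prob (R : SupervisedRBM n₁ n₂) : ∑ c : Config n₁ n₂, R.prob c = 1 := by
  unfold prob
  rw [← Finset.sum_div]
  exact div_self (Finset.sum_pos (fun c _ => Real.exp_pos _) Finset.univ_nonempty).ne'

/-- The joint law of `(X, H, Y)`. -/
def law (R : SupervisedRBM n₁ n₂) : PMF (Config n₁ n₂) :=
  PMF.ofFintype (fun c => ENNReal.ofReal (R.prob c)) (by
    rw [← ENNReal.ofReal_sum_of_nonneg (fun c _ => R.prob_nonneg c), R.sum_prob,
      ENNReal.ofReal_one])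

/-- The law of an observation `(X, Y)`. -/
def sampleLaw (R : SupervisedRBM n₁ n₂) : PMF (Sample n₁) :=
  R.law.map (fun c => (c.1, c.2.2))

/-- The law of `m` independent observations. -/
def samplesLaw (R : SupervisedRBM n₁ n₂) (m : ℕ) : MeasureTheory.Measure (Fin m → Sample n₁) :=
  MeasureTheory.Measure.pi (fun _ => R.sampleLaw.toMeasure)

/-- Minimum ferromagnetic interaction: every weight is zero or at least `α`. -/
def MinFerromagnetic (R : SupervisedRBM n₁ n₂) (α : ℝ) : Prop :=
  ∀ i j, R.W i j = 0 ∨ α ≤ R.W i j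

/-- Conditional sparsity: the visible units, and the hidden units conditionally on one of the two
values of the label, have weights and external field bounded by `lam`. -/
def CondSparse (R : SupervisedRBM n₁ n₂) (lam : ℝ) : Prop :=
  (∀ i, ∑ j, R.W i j + |R.b₁ i| ≤ lam) ∧
    ∃ y : Bool, ∀ j, ∑ i, R.W i j + |R.b₂ j + spin y * R.w j| ≤ lam

/-- Balanced label: `Pr[Y = y] ≥ β` for both values of `y`. -/
def BalancedLabel (R : SupervisedRBM n₁ n₂) (β : ℝ) : Prop :=
  ∀ y : Bool, β ≤ R.law.toMeasure.real {c | c.2.2 = y}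

open Classical in
/-- The two-hop neighbors of the visible unit `u`: the other visible units which share a hidden
neighbor with `u`. -/
def twoHop (R : SupervisedRBM n₁ n₂) (u : Fin n₁) : Finset (Fin n₁) :=
  {v | v ≠ u ∧ ∃ j, R.W u j ≠ 0 ∧ R.W v j ≠ 0}

end SupervisedRBM

/-! ### The greedy algorithm -/

namespace GreedyNbhd

variable {n m : ℕ}

/-- The samples with `X_S = a` and `Y = y`. -/
def cell (s : Fin m → Sample n) (S : Finset (Fin n)) (a : S → Bool) (y : Bool) : Finset (Fin m) :=
  {k | (∀ i : S, (s k).1 i = a i) ∧ (s k).2 = y}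

/-- The empirical conditional mean of `f` given `X_S = a` and `Y = y`. -/
def empMean (s : Fin m → Sample n) (S : Finset (Fin n)) (a : S → Bool) (y : Bool)
    (f : Sample n → ℝ) : ℝ :=
  (∑ k ∈ cell s S a y, f (s k)) / (cell s S a y).card

/-- The empirical covariance of `X_u` and `X_v` given `X_S = a` and `Y = y`. -/
def empCov (s : Fin m → Sample n) (u v : Fin n) (S : Finset (Fin n)) (a : S → Bool) (y : Bool) :
    ℝ :=
  empMean s S a y (fun z => spin (z.1 u) * spin (z.1 v))
    - empMean s S a y (fun z => spin (z.1 u)) * empMean s S a y (fun z => spin (z.1 v))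

/-- The empirical average conditional covariance of `X_u` and `X_v` given `X_S` and `Y`. A value of
`(X_S, Y)` which does not occur among the samples has weight `0`. -/
def empCovAvg (s : Fin m → Sample n) (u v : Fin n) (S : Finset (Fin n)) : ℝ :=
  ∑ a : S → Bool, ∑ y : Bool, ((cell s S a y).card : ℝ) / m * empCov s u v S a y

/-- The values which the variable `S` can take during the greedy phase; ties in the `argmax` may be
broken in any way. -/
inductive Reachable (s : Fin m → Sample n) (u : Fin n) (τ : ℝ) : Finset (Fin n) → Prop
  | empty : Reachable s u τ ∅
  | step (S : Finset (Fin n)) (v : Fin n) : Reachable s u τ S → v ≠ u →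
      (∀ v', v' ≠ u → empCovAvg s u v' S ≤ empCovAvg s u v S) → τ ≤ empCovAvg s u v S →
      Reachable s u τ (insert v S)

/-- One step of the pruning phase. -/
def pruneStep (s : Fin m → Sample n) (u : Fin n) (τ : ℝ) (T : Finset (Fin n)) (v : Fin n) :
    Finset (Fin n) :=
  if empCovAvg s u v (T.erase v) < τ then T.erase v else T

/-- `T` is a possible output of the algorithm: the greedy phase stops at a set `S`, then the elements
of `S` are visited once each, in some order `l`, and what remains is `T`. -/
def IsOutput (s : Fin m → Sample n) (u : Fin n) (τ : ℝ) (T : Finset (Fin n)) : Prop :=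
  ∃ (S : Finset (Fin n)) (l : List (Fin n)),
    Reachable s u τ S ∧ (∀ v, v ≠ u → empCovAvg s u v S < τ) ∧
    l.Nodup ∧ l.toFinset = S ∧ T = l.foldl (pruneStep s u τ) S

/-! ### An implementation with a step count

A unit cost is charged for every elementary operation: a case distinction, a comparison, an
exact arithmetic operation on real numbers, a look-up of a spin, the construction of a list cell or
of a tuple, a projection. -/

/-- A value together with the number of elementary operations used to compute it. -/
structure Timed (A : Type) where
  /-- the result -/
  val : A
  /-- the number of elementary operations -/
  time : ℕ

instance : Monad Timed where
  pure a := ⟨a, 0⟩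
  bind x f := ⟨(f x.val).val, x.time + (f x.val).time⟩

/-- Charge `k` elementary operations. -/
def charge (k : ℕ) : Timed Unit := ⟨(), k⟩

/-- Look up the label (`none`) or a visible unit (`some i`). -/
def look (q : Option (Fin n)) (z : Sample n) : Bool :=
  match q with
  | none => z.2
  | some i => z.1 i

/-- Split a list of samples according to one coordinate. -/
def split (q : Option (Fin n)) : List (Sample n) → Timed (List (Sample n) × List (Sample n))
  | [] => do
    charge 2
    pure ([], [])
  | z :: zs => do
    let r ← split q zs
    charge 7
    if look q z then pure (z :: r.1, r.2) else pure (r.1, z :: r.2)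

/-- Put a group in front of a list of groups, unless it is empty. -/
def consGroup : List (Sample n) → List (List (Sample n)) → Timed (List (List (Sample n)))
  | [], gs => do
    charge 1
    pure gs
  | z :: zs, gs => do
    charge 2
    pure ((z :: zs) :: gs)

/-- Split every group according to one coordinate, dropping empty groups. -/
def refine (q : Option (Fin n)) : List (List (Sample n)) → Timed (List (List (Sample n)))
  | [] => do
    charge 1
    pure []
  | g :: gs => do
    let r ← refine q gs
    let p ← split q g
    charge 1
    let r' ← consGroup p.2 r
    consGroup p.1 r'

/-- Group the samples by the values of the label and of the coordinates in a list. -/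
def groups (L : List (Sample n)) : List (Fin n) → Timed (List (List (Sample n)))
  | [] => do
    charge 2
    refine none [L]
  | i :: l => do
    let gs ← groups L l
    charge 1
    refine (some i) gs

/-- The number of samples in a group, and the sums of `X_u`, `X_v` and `X_u X_v` over it. -/
def groupSums (u v : Fin n) : List (Sample n) → Timed (ℝ × ℝ × ℝ × ℝ)
  | [] => do
    charge 2
    pure (0, 0, 0, 0)
  | z :: zs => do
    let r ← groupSums u v zs
    charge 20
    pure (r.1 + 1, r.2.1 + spin (z.1 u), r.2.2.1 + spin (z.1 v),
      r.2.2.2 + spin (z.1 u) * spin (z.1 v))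

/-- The average conditional covariance from the groups; `M` is the number of samples. -/
def groupsCov (M : ℝ) (u v : Fin n) : List (List (Sample n)) → Timed ℝ
  | [] => do
    charge 1
    pure 0
  | g :: gs => do
    let c ← groupsCov M u v gs
    let r ← groupSums u v g
    charge 20
    pure (c + r.1 / M * (r.2.2.2 / r.1 - r.2.1 / r.1 * (r.2.2.1 / r.1)))

/-- A candidate different from `u` of maximal average conditional covariance, with its value. -/
def best (M : ℝ) (u : Fin n) (gs : List (List (Sample n))) :
    List (Fin n) → Timed (Option (Fin n × ℝ))
  | [] => do
    charge 1
    pure none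
  | v :: l => do
    let r ← best M u gs l
    charge 2
    if v = u then pure r
    else do
      let c ← groupsCov M u v gs
      charge 6
      match r with
      | none => pure (some (v, c))
      | some p => if p.2 ≤ c then pure (some (v, c)) else pure (some p)

/-- The greedy phase, with at most `k` further passes, from the set `S` and the groups of samples
with the same label and the same spins on `S`. -/
def greedy (M : ℝ) (u : Fin n) (τ : ℝ) :
    (k : ℕ) → (S : List (Fin n)) → List (List (Sample n)) → Timed (List (Fin n))
  | 0, S, _ => do
    charge 1
    pure S
  | k + 1, S, gs => do
    let r ← best M u gs (List.finRange n)
    charge 4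
    match r with
    | none => pure S
    | some p =>
      if τ ≤ p.2 then do
        let gs' ← refine (some p.1) gs
        charge 4
        greedy M u τ k (p.1 :: S) gs'
      else pure S

/-- Remove an element from a list. -/
def remove (v : Fin n) : List (Fin n) → Timed (List (Fin n))
  | [] => do
    charge 1
    pure []
  | i :: l => do
    let r ← remove v l
    charge 3
    if i = v then pure r else pure (i :: r)

/-- The pruning phase: the list of elements still to be visited, and the current set. -/
def prune (M : ℝ) (L : List (Sample n)) (u : Fin n) (τ : ℝ) :
    List (Fin n) → List (Fin n) → Timed (List (Fin n))
  | [], T => do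
    charge 1
    pure T
  | v :: l, T => do
    let T' ← remove v T
    let gs ← groups L T'
    let c ← groupsCov M u v gs
    charge 2
    if c < τ then prune M L u τ l T' else prune M L u τ l T

/-- The implementation. The samples are first written into a list, and `m` and `n` are counted. The
greedy phase needs at most `n` passes because its set never contains `u` and grows in every pass but
the last. -/
def run (s : Fin m → Sample n) (u : Fin n) (τ : ℝ) : Timed (List (Fin n)) := do
  charge (3 * m + n + 1)
  let gs ← groups (List.ofFn s) []
  let S ← greedy m u τ n [] gs
  prune m (List.ofFn s) u τ S S

end GreedyNbhd

end

/-! The threshold `τ` separates two situations. Let `S` be a set of visible units not containing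
`u`. If `S` contains the two-hop neighborhood, then given `X_S` and `Y` the unit `u` is independent
of every other visible unit, and the average conditional covariance vanishes (`wcov_spin_eq_zero`).
If `v` is a two-hop neighbor outside `S`, it is at least `β α² exp (-6 lam)`, which is at least `2
τ` because `lam ≥ 0` (`covAvgOf_popE_ge`).

The lower bound is a correlation inequality. In a cell, that is, for fixed values of `X_S` and `Y`,
the weight of visible and hidden units is log-supermodular, so increasing functions are
nonnegatively correlated. Averaging out `X_u` and `X_v` turns them into `tanh` of their fields; each
is `α exp (-2 lam)` times the spin of a shared hidden unit plus an increasing function. So the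
covariance is at least `α² exp (-4 lam)` times the variance of that spin, which is at least `exp (-2
lam)` for the label under which the hidden fields are bounded. Cells with the other label contribute
a nonnegative amount, and the good label has mass at least `β`.

The greedy set stays small for every sample. The empirical variance of `X_u` explained by `X_S` and
`Y` is at most `1`, and inserting `v` raises it by at least the square of the average conditional
covariance (`explainedVar_insert`); hence `|S| ≤ 1 / τ²`. If empirical and true averages differ by
at most `τ / 2` on all such sets, greedy search cannot stop before it contains every neighbor, and
pruning then removes exactly the others (`IsOutput.eq_of_estimates`).

Closeness follows from Hoeffding's inequality and a union bound over the moments of the cells.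
Unlikely cells do no harm: a product of two moments divided by the mass of the cell is a Lipschitz
function of the three, because the moments are bounded by the mass (`abs_mul_div_sub_mul_div_le`).
No lower bound on cell probabilities is needed, and `δ` enters only through `δ ≤ 1`.

For the running time, the samples are kept in nonempty groups, one per occurring cell. There are at
most `m` groups however large `S` is, so a greedy pass costs `O(m n)`. -/

/-! ### Average conditional covariance as a sum over cells -/

/-- The indicator of the event that `X_S` is the vector whose `+1` coordinates are those in `A`, and
that `Y = y`. -/
def cellInd {n : ℕ} (S A : Finset (Fin n)) (y : Bool) (z : Sample n) : ℝ :=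
  if (∀ i ∈ S, z.1 i = decide (i ∈ A)) ∧ z.2 = y then 1 else 0

/-- The contribution of a cell to the average conditional covariance under an expectation `E`. -/
noncomputable def covTerm {n : ℕ} (E : (Sample n → ℝ) → ℝ) (u v : Fin n) (S A : Finset (Fin n))
    (y : Bool) : ℝ :=
  E (fun z => cellInd S A y z * (spin (z.1 u) * spin (z.1 v)))
    - E (fun z => cellInd S A y z * spin (z.1 u)) * E (fun z => cellInd S A y z * spin (z.1 v))
      / E (cellInd S A y)

/-- The average conditional covariance under an expectation `E`. -/
noncomputable def covAvgOf {n : ℕ} (E : (Sample n → ℝ) → ℝ) (u v : Fin n)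
    (S : Finset (Fin n)) : ℝ :=
  ∑ A ∈ S.powerset, ∑ y : Bool, covTerm E u v S A y

/-- The empirical expectation. -/
noncomputable def empE {n m : ℕ} (s : Fin m → Sample n) (f : Sample n → ℝ) : ℝ := (∑ k, f (s k)) / m

theorem spin_mul_self (b : Bool) : spin b * spin b = 1 := by cases b <;> simp [spin]

theorem abs_spin (b : Bool) : |spin b| = 1 := by cases b <;> simp [spin]

theorem cellInd_nonneg {n : ℕ} (S A : Finset (Fin n)) (y : Bool) (z : Sample n) :
    0 ≤ cellInd S A y z := by
  unfold cellInd; split_ifs <;> simp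

theorem cellInd_le_one {n : ℕ} (S A : Finset (Fin n)) (y : Bool) (z : Sample n) :
    cellInd S A y z ≤ 1 := by
  unfold cellInd; split_ifs <;> simp

/-- Indexing cells by subsets of `S` instead of functions on the subtype lets the cells of `insert v
S` be split with `Finset.sum_powerset_insert`. -/
theorem sum_pi_bool_eq_sum_powerset {ι : Type*} [DecidableEq ι] (S : Finset ι)
    (G : (S → Bool) → ℝ) :
    ∑ a : S → Bool, G a = ∑ A ∈ S.powerset, G (fun i => decide (i.1 ∈ A)) := by
  refine Finset.sum_bij' (fun a _ => S.filter (fun i => ∃ h : i ∈ S, a ⟨i, h⟩ = true))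
    (fun A _ => fun i => decide (i.1 ∈ A)) ?_ ?_ ?_ ?_ ?_
  · intro a _
    simp
  · intro A _
    simp
  · intro a _
    funext i
    rcases i with ⟨i, hi⟩
    simp [hi]
  · intro A hA
    ext i
    simp only [Finset.mem_powerset] at hA
    simp only [Finset.mem_filter, decide_eq_true_eq, exists_prop]
    exact ⟨fun h => h.2.2, fun h => ⟨hA h, hA h, h⟩⟩
  · intro a _
    congr 1
    funext i
    rcases i with ⟨i, hi⟩
    simp [hi]

theorem sum_powerset_ite_eq_one {ι : Type*} [DecidableEq ι] (S : Finset ι) (x : ι → Bool) :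
    ∑ A ∈ S.powerset, (if ∀ i ∈ S, x i = decide (i ∈ A) then (1 : ℝ) else 0) = 1 := by
  rw [Finset.sum_eq_single (S.filter (fun i => x i = true))]
  · rw [if_pos]
    intro i hi
    simp [hi]
  · intro A hA hne
    rw [if_neg]
    intro h
    apply hne
    simp only [Finset.mem_powerset] at hA
    ext i
    simp only [Finset.mem_filter]
    constructor
    · intro hi
      exact ⟨hA hi, by simp [h i (hA hi), hi]⟩
    · rintro ⟨hi, hx⟩
      have := h i hi
      rw [hx] at this
      simpa using this.symm
  · intro h
    simp at h

theorem sum_cellInd {n : ℕ} (S : Finset (Fin n)) (z : Sample n) :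
    ∑ A ∈ S.powerset, ∑ y : Bool, cellInd S A y z = 1 := by
  rw [← sum_powerset_ite_eq_one S z.1]
  refine Finset.sum_congr rfl fun A _ => ?_
  rcases z with ⟨x, y⟩
  rw [Fintype.sum_bool]
  unfold cellInd
  cases y <;> simp

theorem cellInd_insert_left {n : ℕ} {S A : Finset (Fin n)} {v : Fin n} (hv : v ∉ S) (hA : A ⊆ S)
    (y : Bool) (z : Sample n) :
    cellInd (insert v S) A y z = cellInd S A y z * ((1 - spin (z.1 v)) / 2) := by
  have hvA : v ∉ A := fun h => hv (hA h)
  unfold cellInd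
  simp only [Finset.forall_mem_insert, hvA, decide_false]
  cases z.1 v <;> simp [spin]

theorem cellInd_insert_insert {n : ℕ} {S A : Finset (Fin n)} {v : Fin n} (hv : v ∉ S)
    (y : Bool) (z : Sample n) :
    cellInd (insert v S) (insert v A) y z = cellInd S A y z * ((1 + spin (z.1 v)) / 2) := by
  have h : (∀ i ∈ S, z.1 i = decide (i ∈ insert v A)) ↔ ∀ i ∈ S, z.1 i = decide (i ∈ A) := by
    refine forall₂_congr fun i hi => ?_
    have : i ≠ v := fun h => hv (h ▸ hi)
    simp [this]
  unfold cellInd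
  simp only [Finset.forall_mem_insert, h, Finset.mem_insert_self, decide_true]
  cases z.1 v <;> simp [spin]

/-- On each cell `X_v` is constant once `v ∈ S`. Since `τ > 0`, this is what prevents the greedy
phase from choosing the same unit twice. -/
theorem covAvgOf_eq_zero_of_mem {n : ℕ} (E : (Sample n → ℝ) → ℝ)
    (hE : ∀ (c : ℝ) f, E (fun z => c * f z) = c * E f)
    (hE0 : ∀ S A y f, (∀ z : Sample n, |f z| ≤ cellInd S A y z) → E (cellInd S A y) = 0 → E f = 0)
    {u v : Fin n} {S : Finset (Fin n)} (hv : v ∈ S) : covAvgOf E u v S = 0 := by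
  refine Finset.sum_eq_zero fun A _ => Finset.sum_eq_zero fun y _ => ?_
  have h : ∀ z : Sample n, cellInd S A y z * spin (z.1 v)
      = spin (decide (v ∈ A)) * cellInd S A y z := by
    intro z
    unfold cellInd
    split_ifs with h
    · rw [h.1 v hv]; ring
    · simp
  have h2 : ∀ z : Sample n, cellInd S A y z * (spin (z.1 u) * spin (z.1 v))
      = spin (decide (v ∈ A)) * (cellInd S A y z * spin (z.1 u)) := by
    intro z
    rw [mul_comm (spin (z.1 u)), ← mul_assoc, h]; ring
  unfold covTerm
  simp only [h, h2, hE]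
  by_cases h0 : E (cellInd S A y) = 0
  · rw [hE0 S A y (fun z => cellInd S A y z * spin (z.1 u)) _ h0]
    · simp
    · intro z
      rw [abs_mul, abs_spin, mul_one, abs_of_nonneg (cellInd_nonneg S A y z)]
  · field_simp
    simp

/-! ### The empirical law and the explained-variance potential -/

section Emp

variable {n m : ℕ} (s : Fin m → Sample n)

theorem empE_mul_left (c : ℝ) (f : Sample n → ℝ) : empE s (fun z => c * f z) = c * empE s f := by
  simp [empE, ← Finset.mul_sum, mul_div_assoc]

theorem empE_mono {f g : Sample n → ℝ} (h : ∀ z, f z ≤ g z) : empE s f ≤ empE s g := by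
  unfold empE
  gcongr
  exact h _

theorem empE_one_le : empE s (fun _ => 1) ≤ 1 := by
  simp only [empE, Finset.sum_const, Finset.card_univ, Fintype.card_fin, nsmul_eq_mul, mul_one]
  exact div_self_le_one _

theorem empE_abs_le {f g : Sample n → ℝ} (h : ∀ z, |f z| ≤ g z) : |empE s f| ≤ empE s g := by
  rw [abs_le]
  constructor
  · have := empE_mono s (f := fun z => (-1) * g z) (g := f)
      (fun z => by have := (abs_le.mp (h z)).1; linarith)
    rw [empE_mul_left] at this
    linarith
  · exact empE_mono s fun z => (abs_le.mp (h z)).2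

theorem empE_eq_zero {f g : Sample n → ℝ} (h : ∀ z, |f z| ≤ g z) (hg : empE s g = 0) :
    empE s f = 0 := by
  have := empE_abs_le s h
  rw [hg] at this
  exact abs_nonpos_iff.mp this

theorem sum_cell (S A : Finset (Fin n)) (y : Bool) (f : Sample n → ℝ) :
    ∑ k ∈ GreedyNbhd.cell s S (fun i => decide (i.1 ∈ A)) y, f (s k)
      = ∑ k, cellInd S A y (s k) * f (s k) := by
  unfold GreedyNbhd.cell cellInd
  rw [Finset.sum_filter]
  refine Finset.sum_congr rfl fun k _ => ?_
  simp

theorem empCovAvg_eq (u v : Fin n) (S : Finset (Fin n)) :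
    GreedyNbhd.empCovAvg s u v S = covAvgOf (empE s) u v S := by
  unfold GreedyNbhd.empCovAvg covAvgOf
  rw [sum_pi_bool_eq_sum_powerset]
  refine Finset.sum_congr rfl fun A _ => Finset.sum_congr rfl fun y _ => ?_
  have hc : ((GreedyNbhd.cell s S (fun i => decide (i.1 ∈ A)) y).card : ℝ)
      = ∑ k, cellInd S A y (s k) := by
    have := sum_cell s S A y (fun _ => 1)
    simpa using this
  unfold GreedyNbhd.empCov GreedyNbhd.empMean covTerm
  rw [sum_cell s S A y (fun z => spin (z.1 u) * spin (z.1 v)),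
    sum_cell s S A y (fun z => spin (z.1 u)), sum_cell s S A y (fun z => spin (z.1 v)), hc]
  rcases Nat.eq_zero_or_pos m with hm | hm
  · subst hm
    simp [empE]
  have hm' : (m : ℝ) ≠ 0 := by positivity
  -- In an empty cell both sides are zero by the convention `x / 0 = 0`.
  by_cases h0 : ∑ k, cellInd S A y (s k) = 0
  · have hz : ∀ k, cellInd S A y (s k) = 0 := fun k =>
      (Finset.sum_eq_zero_iff_of_nonneg (fun k _ => cellInd_nonneg S A y (s k))).mp h0 k
        (Finset.mem_univ k)
    simp [empE, hz]
  · unfold empE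
    field_simp

theorem empCovAvg_eq_zero_of_mem {u v : Fin n} {S : Finset (Fin n)} (hv : v ∈ S) :
    GreedyNbhd.empCovAvg s u v S = 0 := by
  rw [empCovAvg_eq]
  exact covAvgOf_eq_zero_of_mem _ (empE_mul_left s) (fun S A y f h h0 => empE_eq_zero s h h0) hv

theorem sum_empE_cellInd (S : Finset (Fin n)) :
    ∑ A ∈ S.powerset, ∑ y : Bool, empE s (cellInd S A y) = empE s (fun _ => 1) := by
  simp only [empE, ← Finset.sum_div]
  congr 1
  have h : ∀ k ∈ Finset.univ, (1 : ℝ) = ∑ A ∈ S.powerset, ∑ y : Bool, cellInd S A y (s k) :=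
    fun k _ => (sum_cellInd S (s k)).symm
  rw [Finset.sum_congr rfl h]
  rw [Finset.sum_comm (s := Finset.univ) (t := S.powerset)]
  exact Finset.sum_congr rfl fun A _ => Finset.sum_comm

/-- The explained variance of `X_u` given `X_S` and `Y` under the empirical distribution. -/
noncomputable def explainedVar (u : Fin n) (S : Finset (Fin n)) : ℝ :=
  ∑ A ∈ S.powerset, ∑ y : Bool,
    empE s (fun z => cellInd S A y z * spin (z.1 u)) ^ 2 / empE s (cellInd S A y)

theorem explainedVar_nonneg (u : Fin n) (S : Finset (Fin n)) : 0 ≤ explainedVar s u S := by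
  refine Finset.sum_nonneg fun A _ => Finset.sum_nonneg fun y _ => div_nonneg (sq_nonneg _) ?_
  unfold empE
  exact div_nonneg (Finset.sum_nonneg fun k _ => cellInd_nonneg S A y _) (Nat.cast_nonneg m)

/-- The best constant predictor on a cell is `B / N`; any other value `q` explains less. The
hypothesis `|B| ≤ N` covers the empty cell. -/
theorem sq_div_ge {B N : ℝ} (h : |B| ≤ N) (q : ℝ) : 2 * q * B - q ^ 2 * N ≤ B ^ 2 / N := by
  rcases (abs_nonneg B |>.trans h).eq_or_lt with h0 | h0
  · subst h0
    have : B = 0 := abs_nonpos_iff.mp h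
    simp [this]
  · rw [le_div_iff₀ h0]
    nlinarith [sq_nonneg (B - q * N)]

theorem abs_cellInd_mul_spin (S A : Finset (Fin n)) (y : Bool) (z : Sample n) (v : Fin n) :
    |cellInd S A y z * spin (z.1 v)| ≤ cellInd S A y z := by
  rw [abs_mul, abs_spin, mul_one, abs_of_nonneg (cellInd_nonneg S A y z)]

theorem explainedVar_le_one (u : Fin n) (S : Finset (Fin n)) : explainedVar s u S ≤ 1 := by
  refine le_trans ?_ (empE_one_le s)
  rw [← sum_empE_cellInd s S]
  refine Finset.sum_le_sum fun A _ => Finset.sum_le_sum fun y _ => ?_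
  have h := empE_abs_le s (fun z => abs_cellInd_mul_spin S A y z u)
  refine div_le_of_le_mul₀ ((abs_nonneg _).trans h) ((abs_nonneg _).trans h) ?_
  rw [← sq]
  exact sq_le_sq' (by linarith [(abs_le.mp h).1]) (abs_le.mp h).2

/-- Here `N` is the mass of a cell and `B`, `D`, `X` are the integrals of `X_u`, `X_v`, `X_u X_v`
over it. After the cell is split by `X_v`, a linear predictor of `X_u` with slope `t` in `X_v` is
available, and the true conditional means do at least as well. -/
theorem split_gain {N B D X t : ℝ} (hB : |B| ≤ N) (hD : |D| ≤ N)
    (hp : |(B + X) / 2| ≤ (N + D) / 2) (hq : |(B - X) / 2| ≤ (N - D) / 2) :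
    B ^ 2 / N + 2 * t * (X - B * D / N) - t ^ 2 * N
      ≤ ((B - X) / 2) ^ 2 / ((N - D) / 2) + ((B + X) / 2) ^ 2 / ((N + D) / 2) := by
  -- The predictor is `B / N + t (X_v - D / N)`. Its loss term involves `t² N (1 - (D / N)²)`, which
  -- is bounded by `t² N` at the end.
  have h1 := sq_div_ge hq (B / N + t * (-1 - D / N))
  have h2 := sq_div_ge hp (B / N + t * (1 - D / N))
  rcases (abs_nonneg B |>.trans hB).eq_or_lt with h0 | h0
  · subst h0
    have hB0 : B = 0 := abs_nonpos_iff.mp hB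
    have hD0 : D = 0 := abs_nonpos_iff.mp hD
    subst hB0 hD0
    have : X = 0 := by
      simp only [zero_add, add_zero, zero_div] at hp
      have := abs_nonpos_iff.mp hp
      linarith
    simp [this]
  · refine le_trans ?_ (add_le_add h1 h2)
    obtain ⟨p, rfl⟩ : ∃ p, B = p * N := ⟨B / N, by field_simp⟩
    obtain ⟨g, rfl⟩ : ∃ g, D = g * N := ⟨D / N, by field_simp⟩
    have e1 : p * N / N = p := by field_simp
    have e2 : g * N / N = g := by field_simp
    have e3 : (p * N) ^ 2 / N = p ^ 2 * N := by field_simp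
    have e4 : p * N * (g * N) / N = p * g * N := by field_simp
    rw [e1, e2, e3, e4]
    nlinarith [mul_nonneg (mul_nonneg (sq_nonneg t) (sq_nonneg g)) h0.le]

/-- The same slope `t`, the average conditional covariance itself, is used in all cells. Summing
`split_gain` gives a gain of `2 t² - t²` times the total mass, and that mass is at most `1`. -/
theorem explainedVar_insert {u v : Fin n} {S : Finset (Fin n)} (hv : v ∉ S) :
    explainedVar s u S + GreedyNbhd.empCovAvg s u v S ^ 2 ≤ explainedVar s u (insert v S) := by
  set t := GreedyNbhd.empCovAvg s u v S with ht
  have key : explainedVar s u S + 2 * t * t - t ^ 2 * empE s (fun _ => 1)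
      ≤ explainedVar s u (insert v S) := by
    have ht' := ht
    rw [empCovAvg_eq] at ht'
    conv_lhs => rw [show 2 * t * t = 2 * t * covAvgOf (empE s) u v S by rw [← ht']]
    rw [← sum_empE_cellInd s S]
    unfold explainedVar covAvgOf
    rw [Finset.sum_powerset_insert hv]
    simp only [Finset.mul_sum, ← Finset.sum_add_distrib, ← Finset.sum_sub_distrib]
    refine Finset.sum_le_sum fun A hA => Finset.sum_le_sum fun y _ => ?_
    rw [Finset.mem_powerset] at hA
    have hm : ∀ f : Sample n → ℝ, empE s (fun z => cellInd (insert v S) A y z * f z)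
        = (empE s (fun z => cellInd S A y z * f z)
          - empE s (fun z => cellInd S A y z * (f z * spin (z.1 v)))) / 2 := by
      intro f
      simp only [empE, ← sub_div, ← Finset.sum_sub_distrib, div_right_comm _ _ (2 : ℝ)]
      congr 1
      rw [Finset.sum_div]
      refine Finset.sum_congr rfl fun k _ => ?_
      rw [cellInd_insert_left hv hA]; ring
    have hp : ∀ f : Sample n → ℝ, empE s (fun z => cellInd (insert v S) (insert v A) y z * f z)
        = (empE s (fun z => cellInd S A y z * f z)
          + empE s (fun z => cellInd S A y z * (f z * spin (z.1 v)))) / 2 := by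
      intro f
      simp only [empE, ← add_div, ← Finset.sum_add_distrib, div_right_comm _ _ (2 : ℝ)]
      congr 1
      rw [Finset.sum_div]
      refine Finset.sum_congr rfl fun k _ => ?_
      rw [cellInd_insert_insert hv]; ring
    have hm1 := hm (fun _ => 1)
    have hp1 := hp (fun _ => 1)
    simp only [mul_one, one_mul] at hm1 hp1
    have hmu := hm (fun z => spin (z.1 u))
    have hpu := hp (fun z => spin (z.1 u))
    have g := split_gain (t := t) (empE_abs_le s (fun z => abs_cellInd_mul_spin S A y z u))
      (empE_abs_le s (fun z => abs_cellInd_mul_spin S A y z v))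
      (hpu ▸ hp1 ▸ empE_abs_le s (fun z => abs_cellInd_mul_spin _ _ y z u))
      (hmu ▸ hm1 ▸ empE_abs_le s (fun z => abs_cellInd_mul_spin _ _ y z u))
    rw [← hmu, ← hpu, ← hm1, ← hp1] at g
    exact g
  have h1 := empE_one_le s
  nlinarith [mul_le_mul_of_nonneg_left h1 (sq_nonneg t)]

theorem empCovAvg_le_one (u v : Fin n) (S : Finset (Fin n)) :
    GreedyNbhd.empCovAvg s u v S ≤ 1 := by
  by_cases hv : v ∈ S
  · rw [empCovAvg_eq_zero_of_mem s hv]; exact zero_le_one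
  · have h1 := explainedVar_insert s (u := u) hv
    have h2 := explainedVar_le_one s u (insert v S)
    have h3 := explainedVar_nonneg s u S
    nlinarith

end Emp

/-! ### Correctness of the greedy and pruning phases from covariance estimates -/

namespace GreedyNbhd

variable {n m : ℕ} {s : Fin m → Sample n} {u : Fin n} {τ : ℝ}

theorem notMem_of_le_empCovAvg (hτ : 0 < τ) {v : Fin n} {S : Finset (Fin n)}
    (h : τ ≤ empCovAvg s u v S) : v ∉ S := by
  intro hv
  rw [empCovAvg_eq_zero_of_mem s hv] at h
  exact absurd h (not_le.mpr hτ)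

/-- Every insertion raises the explained variance by at least `τ ^ 2`, and it never exceeds `1`. -/
theorem Reachable.card_mul_sq_le (hτ : 0 < τ) {S : Finset (Fin n)} (h : Reachable s u τ S) :
    S.card * τ ^ 2 ≤ 1 := by
  refine le_trans ?_ (explainedVar_le_one s u S)
  induction h with
  | empty => simpa using explainedVar_nonneg s u ∅
  | step S v _ _ _ hle ih =>
    have hv := notMem_of_le_empCovAvg hτ hle
    rw [Finset.card_insert_of_notMem hv]
    have h1 := explainedVar_insert s (u := u) hv
    have h2 : τ ^ 2 ≤ empCovAvg s u v S ^ 2 := pow_le_pow_left₀ hτ.le hle 2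
    push_cast
    linarith

theorem Reachable.notMem {S : Finset (Fin n)} (h : Reachable s u τ S) : u ∉ S := by
  induction h with
  | empty => simp
  | step S v _ hne _ _ ih => simp [ih, hne.symm]

/-- The invariant is that the current set contains `N`. When `v ∉ N` is visited, the rest still
contains `N` and `hupp` forces removal; when `v ∈ N`, `hlow` forbids it. The order of visits is
therefore irrelevant. -/
theorem foldl_pruneStep_eq {N : Finset (Fin n)} {κ : ℝ}
    (hlow : ∀ S : Finset (Fin n), S.card ≤ κ → u ∉ S → ∀ v ∈ N, v ∉ S → τ ≤ empCovAvg s u v S)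
    (hupp : ∀ S : Finset (Fin n), S.card ≤ κ → u ∉ S → ∀ v, v ≠ u → v ∉ S → N ⊆ S →
      empCovAvg s u v S < τ)
    (l : List (Fin n)) (S : Finset (Fin n)) (hS : S.card ≤ κ) (hu : u ∉ S) (hN : N ⊆ S)
    (hl : l.toFinset ⊆ S) (hnd : l.Nodup) :
    l.foldl (pruneStep s u τ) S = S.filter (fun v => v ∈ l → v ∈ N) := by
  induction l generalizing S with
  | nil => simp
  | cons v l ih =>
    have hvS : v ∈ S := hl (by simp)
    have hvu : v ≠ u := fun h => hu (h ▸ hvS)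
    have hnd' := List.nodup_cons.mp hnd
    have hc : ((S.erase v).card : ℝ) ≤ κ :=
      le_trans (by exact_mod_cast Finset.card_le_card (Finset.erase_subset v S)) hS
    have hu' : u ∉ S.erase v := fun h => hu (Finset.mem_of_mem_erase h)
    have hl' : l.toFinset ⊆ S := fun i hi => hl (by
      rw [List.mem_toFinset] at hi ⊢; exact List.mem_cons_of_mem _ hi)
    rw [List.foldl_cons]
    by_cases hvN : v ∈ N
    · have : pruneStep s u τ S v = S := by
        unfold pruneStep
        rw [if_neg (not_lt.mpr (hlow _ hc hu' v hvN (by simp)))]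
      rw [this, ih S hS hu hN hl' hnd'.2]
      refine Finset.filter_congr fun i _ => ?_
      rw [List.mem_cons]
      constructor
      · rintro h (rfl | h')
        · exact hvN
        · exact h h'
      · exact fun h h' => h (Or.inr h')
    · have hN' : N ⊆ S.erase v := fun i hi => Finset.mem_erase.mpr ⟨fun h => hvN (h ▸ hi), hN hi⟩
      have : pruneStep s u τ S v = S.erase v := by
        unfold pruneStep
        rw [if_pos (hupp _ hc hu' v hvu (by simp) hN')]
      rw [this, ih (S.erase v) hc hu' hN' _ hnd'.2]
      · ext i
        simp only [Finset.mem_filter, Finset.mem_erase, List.mem_cons]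
        constructor
        · rintro ⟨⟨h1, h2⟩, h3⟩
          exact ⟨h2, fun h => h3 (h.resolve_left h1)⟩
        · rintro ⟨h1, h2⟩
          exact ⟨⟨fun h => hvN (h ▸ h2 (Or.inl h)), h1⟩, fun h => h2 (Or.inr h)⟩
      · intro i hi
        refine Finset.mem_erase.mpr ⟨fun h => hnd'.1 ?_, hl' hi⟩
        rw [← h]; exact List.mem_toFinset.mp hi

theorem IsOutput.eq_of_estimates {N : Finset (Fin n)} {κ : ℝ} (hτ : 0 < τ) (hκ : 1 / τ ^ 2 ≤ κ)
    (huN : u ∉ N)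
    (hlow : ∀ S : Finset (Fin n), S.card ≤ κ → u ∉ S → ∀ v ∈ N, v ∉ S → τ ≤ empCovAvg s u v S)
    (hupp : ∀ S : Finset (Fin n), S.card ≤ κ → u ∉ S → ∀ v, v ≠ u → v ∉ S → N ⊆ S →
      empCovAvg s u v S < τ)
    {T : Finset (Fin n)} (h : IsOutput s u τ T) : T = N := by
  obtain ⟨S, l, hr, hmax, hnd, hl, rfl⟩ := h
  have hc : (S.card : ℝ) ≤ κ := by
    refine le_trans ?_ hκ
    rw [le_div_iff₀ (by positivity)]
    exact hr.card_mul_sq_le hτ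
  have hN : N ⊆ S := by
    intro v hv
    by_contra hvS
    exact absurd (hlow S hc hr.notMem v hv hvS)
      (not_le.mpr (hmax v (fun h => huN (h ▸ hv))))
  rw [foldl_pruneStep_eq hlow hupp l S hc hr.notMem hN hl.le hnd]
  ext v
  simp only [Finset.mem_filter]
  constructor
  · rintro ⟨h1, h2⟩
    exact h2 (by rw [← List.mem_toFinset, hl]; exact h1)
  · exact fun hv => ⟨hN hv, fun _ => hv⟩

end GreedyNbhd

/-! ### The implementation: values and step counts -/

namespace GreedyNbhd

variable {n m : ℕ}

@[simp] theorem Timed.bind_val {A B : Type} (x : Timed A) (f : A → Timed B) :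
    (x >>= f).val = (f x.val).val := rfl

@[simp] theorem Timed.bind_time {A B : Type} (x : Timed A) (f : A → Timed B) :
    (x >>= f).time = x.time + (f x.val).time := rfl

@[simp] theorem Timed.pure_val {A : Type} (a : A) : (pure a : Timed A).val = a := rfl

@[simp] theorem Timed.pure_time {A : Type} (a : A) : (pure a : Timed A).time = 0 := rfl

@[simp] theorem charge_time (k : ℕ) : (charge k).time = k := rfl

theorem split_val (q : Option (Fin n)) (zs : List (Sample n)) :
    (split q zs).val = (zs.filter (fun z => look q z), zs.filter (fun z => !look q z)) := by
  induction zs with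
  | nil => simp [split]
  | cons z zs ih =>
    simp only [split, Timed.bind_val]
    cases h : look q z <;> simp [h, ih]

theorem split_time (q : Option (Fin n)) (zs : List (Sample n)) :
    (split q zs).time = 2 + 7 * zs.length := by
  induction zs with
  | nil => simp [split]
  | cons z zs ih =>
    simp only [split, Timed.bind_time, List.length_cons]
    cases h : look q z <;> simp [ih] <;> ring

theorem consGroup_val (g : List (Sample n)) (gs : List (List (Sample n))) :
    (consGroup g gs).val = if g = [] then gs else g :: gs := by
  cases g <;> simp [consGroup]

theorem consGroup_time (g : List (Sample n)) (gs : List (List (Sample n))) :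
    (consGroup g gs).time ≤ 2 := by
  cases g <;> simp [consGroup]

theorem sum_map_consGroup {M : Type*} [AddCommMonoid M] (φ : List (Sample n) → M) (h0 : φ [] = 0)
    (g : List (Sample n)) (gs : List (List (Sample n))) :
    ((consGroup g gs).val.map φ).sum = φ g + (gs.map φ).sum := by
  rw [consGroup_val]
  split_ifs with h
  · simp [h, h0]
  · simp

/-- Sums of a statistic vanishing on `[]` do not notice that empty groups are dropped. Taking `φ`
arbitrary serves both the covariance and the total length. -/
theorem sum_map_refine {M : Type*} [AddCommMonoid M] (φ : List (Sample n) → M) (h0 : φ [] = 0)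
    (q : Option (Fin n)) (gs : List (List (Sample n))) :
    ((refine q gs).val.map φ).sum = (gs.map (fun g =>
      φ (g.filter (fun z => look q z)) + φ (g.filter (fun z => !look q z)))).sum := by
  induction gs with
  | nil => simp [refine]
  | cons g gs ih =>
    simp only [refine, Timed.bind_val, sum_map_consGroup φ h0, ih, split_val, List.map_cons,
      List.sum_cons, add_assoc]

/-- The groups are nonempty and contain `m` samples in total. -/
def IsGrouping (m : ℕ) (gs : List (List (Sample n))) : Prop :=
  (∀ g ∈ gs, g ≠ []) ∧ (gs.map List.length).sum = m

/-- This keeps the cost linear in `m` instead of proportional to the `2 ^ (|S| + 1)` potential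
cells. -/
theorem IsGrouping.length_le {gs : List (List (Sample n))} (h : IsGrouping m gs) :
    gs.length ≤ m := by
  rw [← h.2]
  have := List.length_le_sum_of_one_le (gs.map List.length) (by
    intro i hi
    obtain ⟨g, hg, rfl⟩ := List.mem_map.mp hi
    exact List.length_pos_iff.mpr (h.1 g hg))
  simpa using this

theorem mem_refine_ne_nil (q : Option (Fin n)) (gs : List (List (Sample n))) :
    ∀ g ∈ (refine q gs).val, g ≠ [] := by
  induction gs with
  | nil => simp [refine]
  | cons g gs ih =>
    have h : ∀ g' gs', (∀ g ∈ gs', g ≠ []) → ∀ g ∈ (consGroup (n := n) g' gs').val, g ≠ [] := by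
      intro g' gs' h
      rw [consGroup_val]
      split_ifs with h'
      · exact h
      · intro g hg
        rcases List.mem_cons.mp hg with rfl | hg
        · exact h'
        · exact h g hg
    simp only [refine, Timed.bind_val]
    exact h _ _ (h _ _ ih)

theorem refine_isGrouping (q : Option (Fin n)) {gs : List (List (Sample n))}
    (h : (gs.map List.length).sum = m) : IsGrouping m (refine q gs).val := by
  refine ⟨mem_refine_ne_nil q gs, ?_⟩
  rw [sum_map_refine List.length rfl, ← h]
  congr 1
  refine List.map_congr_left fun g _ => ?_
  exact (List.length_eq_length_filter_add _).symm

theorem refine_time (q : Option (Fin n)) (gs : List (List (Sample n))) :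
    (refine q gs).time ≤ 1 + 7 * gs.length + 7 * (gs.map List.length).sum := by
  induction gs with
  | nil => simp [refine]
  | cons g gs ih =>
    simp only [refine, Timed.bind_time, split_time, charge_time, List.length_cons, List.map_cons,
      List.sum_cons]
    have h1 := consGroup_time (split q g).val.2 (refine q gs).val
    have h2 := consGroup_time (split q g).val.1 (consGroup (split q g).val.2 (refine q gs).val).val
    omega

theorem groups_isGrouping (L : List (Sample n)) (l : List (Fin n)) :
    IsGrouping L.length (groups L l).val := by
  induction l with
  | nil =>
    simp only [groups, Timed.bind_val]
    exact refine_isGrouping _ (by simp)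
  | cons i l ih =>
    simp only [groups, Timed.bind_val]
    exact refine_isGrouping _ ih.2

theorem groups_time (L : List (Sample n)) (l : List (Fin n)) :
    (groups L l).time ≤ 10 + 7 * L.length + l.length * (2 + 14 * L.length) := by
  induction l with
  | nil =>
    simp only [groups, Timed.bind_time, charge_time]
    have := refine_time none [L]
    simp at this
    simp
    omega
  | cons i l ih =>
    simp only [groups, Timed.bind_time, charge_time, List.length_cons]
    have h1 := refine_time (some i) (groups L l).val
    have h2 := (groups_isGrouping L l).2
    have h3 := (groups_isGrouping L l).length_le
    have h4 : (l.length + 1) * (2 + 14 * L.length)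
      = l.length * (2 + 14 * L.length) + (2 + 14 * L.length) := by ring
    omega

/-- The samples of a list which lie in a cell. -/
def cellList (L : List (Sample n)) (S A : Finset (Fin n)) (y : Bool) : List (Sample n) :=
  L.filter (fun z => decide ((∀ i ∈ S, z.1 i = decide (i ∈ A)) ∧ z.2 = y))

/-- The induction generalizes `φ`: refining by one more coordinate amounts to replacing `φ` by the
sum of its values on the two halves of a group. -/
theorem sum_map_groups {M : Type*} [AddCommMonoid M] (φ : List (Sample n) → M) (h0 : φ [] = 0)
    (L : List (Sample n)) {l : List (Fin n)} (hl : l.Nodup) :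
    ((groups L l).val.map φ).sum
      = ∑ A ∈ l.toFinset.powerset, ∑ y : Bool, φ (cellList L l.toFinset A y) := by
  induction l generalizing φ with
  | nil =>
    simp only [groups, Timed.bind_val, sum_map_refine φ h0]
    simp [cellList, look]
  | cons i l ih =>
    obtain ⟨hi, hl⟩ := List.nodup_cons.mp hl
    simp only [groups, Timed.bind_val, sum_map_refine φ h0]
    rw [ih (fun g => φ (g.filter (fun z => look (some i) z))
      + φ (g.filter (fun z => !look (some i) z))) (by simp [h0]) hl]
    have hi' : i ∉ l.toFinset := by simpa using hi
    rw [List.toFinset_cons, Finset.sum_powerset_insert hi', ← Finset.sum_add_distrib]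
    refine Finset.sum_congr rfl fun A hA => ?_
    rw [← Finset.sum_add_distrib]
    refine Finset.sum_congr rfl fun y _ => ?_
    rw [Finset.mem_powerset] at hA
    have hiA : i ∉ A := fun h => hi' (hA h)
    rw [add_comm]
    unfold cellList look
    simp only [List.filter_filter]
    congr 2
    · refine List.filter_congr fun z _ => ?_
      rw [Bool.eq_iff_iff]
      simp only [Finset.forall_mem_insert, hiA, decide_false, Bool.not_eq_true', and_assoc,
        Bool.and_eq_true, decide_eq_true_eq]
    · refine List.filter_congr fun z _ => ?_
      rw [Bool.eq_iff_iff]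
      have h : (∀ j ∈ l.toFinset, z.1 j = decide (j ∈ insert i A))
          ↔ ∀ j ∈ l.toFinset, z.1 j = decide (j ∈ A) := by
        refine forall₂_congr fun j hj => ?_
        have : j ≠ i := fun h => hi' (h ▸ hj)
        simp [this]
      simp only [Finset.forall_mem_insert, h, Finset.mem_insert_self, decide_true, and_assoc,
        Bool.and_eq_true, decide_eq_true_eq]

theorem groupSums_val (u v : Fin n) (g : List (Sample n)) :
    (groupSums u v g).val = ((g.map (fun _ => (1 : ℝ))).sum, (g.map (fun z => spin (z.1 u))).sum,
      (g.map (fun z => spin (z.1 v))).sum,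
      (g.map (fun z => spin (z.1 u) * spin (z.1 v))).sum) := by
  induction g with
  | nil => simp [groupSums]
  | cons z g ih => simp [groupSums, ih, add_comm]

theorem groupSums_time (u v : Fin n) (g : List (Sample n)) :
    (groupSums u v g).time = 2 + 20 * g.length := by
  induction g with
  | nil => simp [groupSums]
  | cons z g ih => simp [groupSums, ih]; ring

theorem groupsCov_val (M : ℝ) (u v : Fin n) (gs : List (List (Sample n))) :
    (groupsCov M u v gs).val = (gs.map (fun g =>
      (groupSums u v g).val.1 / M * ((groupSums u v g).val.2.2.2 / (groupSums u v g).val.1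
        - (groupSums u v g).val.2.1 / (groupSums u v g).val.1
          * ((groupSums u v g).val.2.2.1 / (groupSums u v g).val.1)))).sum := by
  induction gs with
  | nil => simp [groupsCov]
  | cons g gs ih => simp [groupsCov, ih, add_comm]

theorem groupsCov_time_le (M : ℝ) (u v : Fin n) (gs : List (List (Sample n))) :
    (groupsCov M u v gs).time ≤ 1 + 22 * gs.length + 20 * (gs.map List.length).sum := by
  induction gs with
  | nil => simp [groupsCov]
  | cons g gs ih => simp [groupsCov, groupSums_time]; omega

theorem IsGrouping.groupsCov_time {gs : List (List (Sample n))} (h : IsGrouping m gs)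
    (M : ℝ) (u v : Fin n) : (groupsCov M u v gs).time ≤ 1 + 42 * m := by
  have h1 := groupsCov_time_le M u v gs
  have h2 := h.length_le
  have h3 := h.2
  omega

theorem sum_map_cellList (s : Fin m → Sample n) (S A : Finset (Fin n)) (y : Bool)
    (f : Sample n → ℝ) :
    ((cellList (List.ofFn s) S A y).map f).sum = ∑ k, cellInd S A y (s k) * f (s k) := by
  have h : ∀ L : List (Sample n), ((cellList L S A y).map f).sum
      = (L.map (fun z => cellInd S A y z * f z)).sum := by
    intro L
    induction L with
    | nil => simp [cellList]
    | cons z L ih =>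
      unfold cellList at ih ⊢
      rw [List.filter_cons, List.map_cons, List.sum_cons, ← ih]
      unfold cellInd
      simp only [decide_eq_true_eq]
      split_ifs <;> simp
  rw [h, List.map_ofFn, List.sum_ofFn]
  rfl

theorem groupsCov_groups (s : Fin m → Sample n) (u v : Fin n) {l : List (Fin n)} (hl : l.Nodup) :
    (groupsCov m u v (groups (List.ofFn s) l).val).val = empCovAvg s u v l.toFinset := by
  rw [groupsCov_val, sum_map_groups _ (by simp [groupSums_val]) _ hl, empCovAvg,
    sum_pi_bool_eq_sum_powerset]
  refine Finset.sum_congr rfl fun A _ => Finset.sum_congr rfl fun y _ => ?_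
  have hc : ((cell s l.toFinset (fun i => decide (i.1 ∈ A)) y).card : ℝ)
      = ∑ k, cellInd l.toFinset A y (s k) * 1 := by
    rw [← sum_cell s l.toFinset A y (fun _ => 1)]
    simp
  simp only [groupSums_val, sum_map_cellList]
  unfold empCov empMean
  rw [sum_cell s l.toFinset A y (fun z => spin (z.1 u) * spin (z.1 v)),
    sum_cell s l.toFinset A y (fun z => spin (z.1 u)),
    sum_cell s l.toFinset A y (fun z => spin (z.1 v)), hc]

theorem best_spec (M : ℝ) (u : Fin n) (gs : List (List (Sample n))) (l : List (Fin n)) :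
    match (best M u gs l).val with
    | none => ∀ v ∈ l, v = u
    | some p => p.1 ≠ u ∧ p.2 = (groupsCov M u p.1 gs).val ∧
        ∀ v ∈ l, v ≠ u → (groupsCov M u v gs).val ≤ p.2 := by
  induction l with
  | nil => simp [best]
  | cons v l ih =>
    simp only [best, Timed.bind_val]
    by_cases hv : v = u
    · rw [if_pos hv]
      simp only [Timed.pure_val]
      cases h : (best M u gs l).val with
      | none =>
        rw [h] at ih
        simpa [hv] using ih
      | some p =>
        rw [h] at ih
        refine ⟨ih.1, ih.2.1, ?_⟩
        intro w hw hwu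
        rcases List.mem_cons.mp hw with rfl | hw
        · exact absurd hv hwu
        · exact ih.2.2 w hw hwu
    · rw [if_neg hv]
      cases h : (best M u gs l).val with
      | none =>
        rw [h] at ih
        simp only [Timed.bind_val, Timed.pure_val]
        refine ⟨hv, trivial, ?_⟩
        intro w hw hwu
        rcases List.mem_cons.mp hw with rfl | hw
        · exact le_rfl
        · exact absurd (ih w hw) hwu
      | some p =>
        rw [h] at ih
        simp only [Timed.bind_val]
        by_cases hp : p.2 ≤ (groupsCov M u v gs).val
        · rw [if_pos hp]
          refine ⟨hv, rfl, ?_⟩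
          intro w hw hwu
          rcases List.mem_cons.mp hw with rfl | hw
          · exact le_rfl
          · exact (ih.2.2 w hw hwu).trans hp
        · rw [if_neg hp]
          refine ⟨ih.1, ih.2.1, ?_⟩
          intro w hw hwu
          rcases List.mem_cons.mp hw with rfl | hw
          · exact (not_le.mp hp).le
          · exact ih.2.2 w hw hwu

theorem best_time {gs : List (List (Sample n))} (h : IsGrouping m gs) (M : ℝ) (u : Fin n)
    (l : List (Fin n)) : (best M u gs l).time ≤ 1 + l.length * (9 + 42 * m) := by
  induction l with
  | nil => simp [best]
  | cons v l ih =>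
    have h1 := h.groupsCov_time M u v
    have h2 : (l.length + 1) * (9 + 42 * m) = l.length * (9 + 42 * m) + (9 + 42 * m) := by ring
    simp only [best, Timed.bind_time, charge_time, List.length_cons]
    by_cases hv : v = u
    · rw [if_pos hv]
      simp only [Timed.pure_time]
      omega
    · rw [if_neg hv]
      simp only [Timed.bind_time, charge_time]
      cases (best M u gs l).val with
      | none =>
        simp only [Timed.pure_time]
        omega
      | some p =>
        by_cases hp : p.2 ≤ (groupsCov M u v gs).val
        · simp only [if_pos hp, Timed.pure_time]
          omega
        · simp only [if_neg hp, Timed.pure_time]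
          omega

/-- The time bound is in telescoping form: each pass costs at most `10 + 14 * m + n * (9 + 42 * m)`,
and every pass but the last lengthens the list by one. -/
theorem greedy_spec (s : Fin m → Sample n) (u : Fin n) {τ : ℝ} (hτ : 0 < τ) (k : ℕ)
    (S : List (Fin n)) (hS : S.Nodup) (hr : Reachable s u τ S.toFinset) (hk : n ≤ k + S.length) :
    ∃ out : List (Fin n), (greedy m u τ k S (groups (List.ofFn s) S).val).val = out ∧ out.Nodup ∧
      Reachable s u τ out.toFinset ∧ (∀ v, v ≠ u → empCovAvg s u v out.toFinset < τ) ∧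
      (greedy m u τ k S (groups (List.ofFn s) S).val).time
          + S.length * (10 + 14 * m + n * (9 + 42 * m))
        ≤ (out.length + 1) * (10 + 14 * m + n * (9 + 42 * m)) := by
  induction k generalizing S with
  | zero =>
    -- The fuel cannot run out: the list has no repetitions and avoids `u`, so its length is less
    -- than `n`.
    exfalso
    have h1 : S.toFinset ⊂ Finset.univ :=
      Finset.ssubset_univ_iff.mpr fun h => hr.notMem (h ▸ Finset.mem_univ u)
    have h2 := Finset.card_lt_card h1
    rw [List.toFinset_card_of_nodup hS] at h2
    simp at h2
    omega
  | succ k ih =>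
    have hg : IsGrouping m (groups (List.ofFn s) S).val := by
      simpa using groups_isGrouping (List.ofFn s) S
    have hb := best_spec m u (groups (List.ofFn s) S).val (List.finRange n)
    have hbt := best_time hg m u (List.finRange n)
    rw [List.length_finRange] at hbt
    have hB : (S.length + 1) * (10 + 14 * m + n * (9 + 42 * m))
      = S.length * (10 + 14 * m + n * (9 + 42 * m)) + (10 + 14 * m + n * (9 + 42 * m)) := by ring
    simp only [greedy, Timed.bind_val, Timed.bind_time, charge_time]
    cases h : (best m u (groups (List.ofFn s) S).val (List.finRange n)).val with
    | none =>
      rw [h] at hb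
      refine ⟨S, rfl, hS, hr, fun v hv => absurd (hb v (List.mem_finRange v)) hv, ?_⟩
      simp only [Timed.pure_time]
      omega
    | some p =>
      rw [h] at hb
      obtain ⟨h1, h2, h3⟩ := hb
      simp only [groupsCov_groups s u _ hS] at h2 h3
      by_cases hp : τ ≤ p.2
      · simp only [if_pos hp, Timed.bind_val, Timed.bind_time, charge_time]
        rw [h2] at hp h3
        have hpS := notMem_of_le_empCovAvg hτ hp
        have hS' : (p.1 :: S).Nodup := List.nodup_cons.mpr ⟨by simpa using hpS, hS⟩
        obtain ⟨out, e, o1, o2, o3, o4⟩ := ih (p.1 :: S) hS'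
          (by
            rw [List.toFinset_cons]
            exact Reachable.step _ _ hr h1 (fun v hv => h3 v (List.mem_finRange v) hv) hp)
          (by rw [List.length_cons]; omega)
        -- Refining the current groups agrees with grouping from scratch, which carries the
        -- invariant to the next pass.
        have hgr : (groups (List.ofFn s) (p.1 :: S)).val
            = (refine (some p.1) (groups (List.ofFn s) S).val).val := rfl
        rw [hgr] at e o4
        refine ⟨out, e, o1, o2, o3, ?_⟩
        rw [List.length_cons, hB] at o4
        have hrt := refine_time (some p.1) (groups (List.ofFn s) S).val
        have h5 := hg.length_le
        have h6 := hg.2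
        omega
      · simp only [if_neg hp, Timed.pure_val, Timed.pure_time]
        refine ⟨S, rfl, hS, hr, fun v hv => ?_, ?_⟩
        · exact (h3 v (List.mem_finRange v) hv).trans_lt (not_le.mp hp)
        · omega

theorem remove_val (v : Fin n) (l : List (Fin n)) :
    (remove v l).val = l.filter (fun i => decide (i ≠ v)) := by
  induction l with
  | nil => simp [remove]
  | cons i l ih =>
    simp only [remove, Timed.bind_val]
    by_cases h : i = v <;> simp [h, ih]

theorem remove_time (v : Fin n) (l : List (Fin n)) : (remove v l).time = 1 + 3 * l.length := by
  induction l with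
  | nil => simp [remove]
  | cons i l ih =>
    simp only [remove, Timed.bind_time, charge_time, ih, List.length_cons]
    by_cases h : i = v <;> simp [h] <;> ring

theorem prune_spec (s : Fin m → Sample n) (u : Fin n) (τ : ℝ) (K : ℕ) (l T : List (Fin n))
    (hT : T.Nodup) (hK : T.length ≤ K) :
    (prune m (List.ofFn s) u τ l T).val.toFinset = l.foldl (pruneStep s u τ) T.toFinset ∧
      (prune m (List.ofFn s) u τ l T).time
        ≤ 1 + l.length * (14 + 49 * m + 3 * K + K * (2 + 14 * m)) := by
  induction l generalizing T with
  | nil => simp [prune]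
  | cons v l ih =>
    have hrv := remove_val v T
    have hrt := remove_time v T
    set T' := (remove v T).val with hT'
    have hnd : T'.Nodup := hrv ▸ hT.filter _
    have hlen : T'.length ≤ K := (hrv ▸ List.length_filter_le _ T).trans hK
    have hfin : T'.toFinset = T.toFinset.erase v := by
      ext i
      rw [hrv]
      simp [and_comm]
    have hgt := groups_time (List.ofFn s) T'
    rw [List.length_ofFn] at hgt
    have hg : IsGrouping m (groups (List.ofFn s) T').val := by
      simpa using groups_isGrouping (List.ofFn s) T'
    have hct := hg.groupsCov_time m u v
    have hB : (l.length + 1) * (14 + 49 * m + 3 * K + K * (2 + 14 * m))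
      = l.length * (14 + 49 * m + 3 * K + K * (2 + 14 * m))
        + (14 + 49 * m + 3 * K + K * (2 + 14 * m)) := by ring
    have hmul : T'.length * (2 + 14 * m) ≤ K * (2 + 14 * m) := Nat.mul_le_mul_right _ hlen
    simp only [prune, Timed.bind_val, Timed.bind_time, charge_time, List.length_cons,
      List.foldl_cons, ← hT', groupsCov_groups s u v hnd, pruneStep, ← hfin]
    by_cases hc : empCovAvg s u v T'.toFinset < τ
    · simp only [if_pos hc]
      obtain ⟨i1, i2⟩ := ih T' hnd hlen
      exact ⟨i1, by omega⟩
    · simp only [if_neg hc]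
      obtain ⟨i1, i2⟩ := ih T hT hK
      exact ⟨i1, by omega⟩

/-- Regrouping during pruning costs `O(K m)` per visit; `K ≤ n` brings this down to the `O(m n)` of
a greedy pass. -/
theorem total_time_le {K m n : ℕ} (hm : 0 < m) (hn : 0 < n) (hK : K ≤ n) :
    3 * m + n + 1 + ((10 + 7 * m) + ((K + 1) * (10 + 14 * m + n * (9 + 42 * m))
      + (1 + K * (14 + 49 * m + 3 * K + K * (2 + 14 * m))))) ≤ 200 * ((K + 1) * m * n) := by
  have h1 : 1 ≤ m * n := Nat.mul_pos hm hn
  have h2 : m ≤ m * n := Nat.le_mul_of_pos_right m hn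
  have h3 : n ≤ m * n := Nat.le_mul_of_pos_left n hm
  have h4 : K ≤ m * n := hK.trans h3
  have h5 : m * K ≤ m * n := Nat.mul_le_mul_left m hK
  have h6 : 10 + 14 * m + n * (9 + 42 * m) ≤ 75 * (m * n) := by nlinarith
  have h7 : 14 + 49 * m + 3 * K + K * (2 + 14 * m) ≤ 82 * (m * n) := by nlinarith
  have h8 := Nat.mul_le_mul_left (K + 1) h6
  have h9 := Nat.mul_le_mul_left K h7
  have h10 : m * n ≤ (K + 1) * (m * n) := Nat.le_mul_of_pos_left _ (Nat.succ_pos K)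
  nlinarith

theorem run_spec (s : Fin m → Sample n) (u : Fin n) {τ : ℝ} (hτ : 0 < τ) (hm : 0 < m) :
    IsOutput s u τ (run s u τ).val.toFinset ∧
      ((run s u τ).time : ℝ) ≤ 400 * (max 1 (8 / τ ^ 2) * m * n) := by
  obtain ⟨S, e, o1, o2, o3, o4⟩ := greedy_spec s u hτ n [] List.nodup_nil
    (by simpa using Reachable.empty) (by simp)
  obtain ⟨p1, p2⟩ := prune_spec s u τ S.length S S o1 le_rfl
  have hgt := groups_time (List.ofFn s) []
  simp only [List.length_ofFn, List.length_nil, zero_mul, add_zero] at hgt o4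
  have hn : 0 < n := Fin.pos u
  have hSn : S.length ≤ n := by
    have := Finset.card_le_univ S.toFinset
    rw [List.toFinset_card_of_nodup o1] at this
    simpa using this
  have hT : (S.length : ℝ) + 1 ≤ 2 * max 1 (8 / τ ^ 2) := by
    have h1 := o2.card_mul_sq_le hτ
    rw [List.toFinset_card_of_nodup o1, ← le_div_iff₀ (by positivity)] at h1
    have h2 : 1 / τ ^ 2 ≤ 8 / τ ^ 2 := by gcongr; norm_num
    linarith [le_max_left 1 (8 / τ ^ 2), le_max_right 1 (8 / τ ^ 2)]
  simp only [run, Timed.bind_val, Timed.bind_time, charge_time, e]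
  refine ⟨⟨S.toFinset, S, o2, o3, o1, rfl, p1⟩, ?_⟩
  set K := S.length
  have key : 3 * m + n + 1 + ((10 + 7 * m) + ((K + 1) * (10 + 14 * m + n * (9 + 42 * m))
      + (1 + K * (14 + 49 * m + 3 * K + K * (2 + 14 * m))))) ≤ 200 * ((K + 1) * m * n) :=
    total_time_le hm hn hSn
  have key' : 3 * m + n + 1 + ((groups (List.ofFn s) []).time
      + ((greedy m u τ n [] (groups (List.ofFn s) []).val).time
        + (prune m (List.ofFn s) u τ S S).time)) ≤ 200 * ((K + 1) * m * n) := by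
    omega
  have key'' : ((3 * m + n + 1 + ((groups (List.ofFn s) []).time
      + ((greedy m u τ n [] (groups (List.ofFn s) []).val).time
        + (prune m (List.ofFn s) u τ S S).time)) : ℕ) : ℝ) ≤ 200 * ((K + 1) * m * n) := by
    exact_mod_cast key'
  refine key''.trans ?_
  have : ((K : ℝ) + 1) * m * n ≤ 2 * max 1 (8 / τ ^ 2) * m * n := by gcongr
  linarith

end GreedyNbhd

/-! ### Correlation inequalities and the slope of `tanh` -/

theorem fkg_of_monotone {α : Type*} [DistribLattice α] [Fintype α] {μ f g : α → ℝ}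
    (hμ₀ : 0 ≤ μ) (hf : Monotone f) (hg : Monotone g)
    (hμ : ∀ a b, μ a * μ b ≤ μ (a ⊓ b) * μ (a ⊔ b)) :
    (∑ a, μ a * f a) * ∑ a, μ a * g a ≤ (∑ a, μ a) * ∑ a, μ a * (f a * g a) := by
  have hb : ∀ f : α → ℝ, ∃ M, ∀ a, 0 ≤ f a + M := by
    intro f
    refine ⟨∑ a, |f a|, fun a => ?_⟩
    have := Finset.single_le_sum (f := fun a => |f a|) (fun a _ => abs_nonneg _) (Finset.mem_univ a)
    have h2 := neg_abs_le (f a)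
    linarith
  obtain ⟨M, hM⟩ := hb f
  obtain ⟨N, hN⟩ := hb g
  -- `fkg` is for nonnegative functions; adding constants leaves the covariance unchanged.
  have := fkg (fun a => f a + M) (fun a => g a + N) μ hμ₀ hM hN
    (fun a b h => add_le_add_left (hf h) M) (fun a b h => add_le_add_left (hg h) N) hμ
  have e : ∀ a, μ a * ((f a + M) * (g a + N))
      = μ a * (f a * g a) + N * (μ a * f a) + M * (μ a * g a) + M * N * μ a := fun a => by ring
  have e1 : ∀ a, μ a * (f a + M) = μ a * f a + M * μ a := fun a => by ring
  have e2 : ∀ a, μ a * (g a + N) = μ a * g a + N * μ a := fun a => by ring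
  simp only [e, e1, e2, Finset.sum_add_distrib, ← Finset.mul_sum] at this
  linarith

/-- The unnormalized covariance of `f` and `g` under the weights `μ`. -/
noncomputable def wcov {α : Type*} [Fintype α] (μ f g : α → ℝ) : ℝ :=
  (∑ a, μ a) * (∑ a, μ a * (f a * g a)) - (∑ a, μ a * f a) * ∑ a, μ a * g a

theorem wcov_nonneg {α : Type*} [DistribLattice α] [Fintype α] {μ f g : α → ℝ}
    (hμ₀ : 0 ≤ μ) (hf : Monotone f) (hg : Monotone g)
    (hμ : ∀ a b, μ a * μ b ≤ μ (a ⊓ b) * μ (a ⊔ b)) : 0 ≤ wcov μ f g :=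
  sub_nonneg.mpr (fkg_of_monotone hμ₀ hf hg hμ)

/-- Write `f` and `g` as `c h` plus an increasing remainder and expand bilinearly; the three terms
containing a remainder are nonnegative by FKG. -/
theorem wcov_ge {α : Type*} [DistribLattice α] [Fintype α] {μ f g h : α → ℝ} {c : ℝ} (hc : 0 ≤ c)
    (hμ₀ : 0 ≤ μ) (hf : Monotone (fun a => f a - c * h a)) (hg : Monotone (fun a => g a - c * h a))
    (hh : Monotone h) (hμ : ∀ a b, μ a * μ b ≤ μ (a ⊓ b) * μ (a ⊔ b)) :
    c ^ 2 * wcov μ h h ≤ wcov μ f g := by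
  have h1 := wcov_nonneg hμ₀ hf hg hμ
  have h2 := mul_nonneg hc (wcov_nonneg hμ₀ hf hh hμ)
  have h3 := mul_nonneg hc (wcov_nonneg hμ₀ hh hg hμ)
  have e : wcov μ f g = c ^ 2 * wcov μ h h + c * wcov μ (fun a => f a - c * h a) h
      + c * wcov μ h (fun a => g a - c * h a)
      + wcov μ (fun a => f a - c * h a) (fun a => g a - c * h a) := by
    have e1 : ∀ a, μ a * ((f a - c * h a) * (g a - c * h a))
      = μ a * (f a * g a) - c * (μ a * (f a * h a)) - c * (μ a * (h a * g a))
        + c ^ 2 * (μ a * (h a * h a)) := fun a => by ring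
    have e2 : ∀ a, μ a * (h a * (g a - c * h a))
      = μ a * (h a * g a) - c * (μ a * (h a * h a)) := fun a => by ring
    have e3 : ∀ a, μ a * ((f a - c * h a) * h a)
      = μ a * (f a * h a) - c * (μ a * (h a * h a)) := fun a => by ring
    have e4 : ∀ a, μ a * (f a - c * h a) = μ a * f a - c * (μ a * h a) := fun a => by ring
    have e5 : ∀ a, μ a * (g a - c * h a) = μ a * g a - c * (μ a * h a) := fun a => by ring
    simp only [wcov, e1, e2, e3, e4, e5, Finset.sum_add_distrib, Finset.sum_sub_distrib,
      ← Finset.mul_sum]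
    ring
  linarith

theorem tanh_sub_tanh_ge {a b L : ℝ} (hab : a ≤ b) (ha : |a| ≤ L) (hb : |b| ≤ L) :
    Real.exp (-2 * L) * (b - a) ≤ Real.tanh b - Real.tanh a := by
  have hL : 0 ≤ L := (abs_nonneg a).trans ha
  have hcosh : ∀ x, |x| ≤ L → Real.cosh x ≤ Real.exp L := by
    intro x hx
    rw [Real.cosh_eq]
    have h1 : Real.exp x ≤ Real.exp L := Real.exp_le_exp.mpr (abs_le.mp hx).2
    have h2 : Real.exp (-x) ≤ Real.exp L := Real.exp_le_exp.mpr (by linarith [(abs_le.mp hx).1])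
    linarith
  have e : Real.tanh b - Real.tanh a = Real.sinh (b - a) / (Real.cosh a * Real.cosh b) := by
    rw [Real.tanh_eq_sinh_div_cosh, Real.tanh_eq_sinh_div_cosh, Real.sinh_sub]
    have := (Real.cosh_pos a).ne'
    have := (Real.cosh_pos b).ne'
    field_simp
  have hs : b - a ≤ Real.sinh (b - a) := Real.self_le_sinh_iff.mpr (by linarith)
  rw [e, le_div_iff₀ (mul_pos (Real.cosh_pos a) (Real.cosh_pos b))]
  have hcc : Real.cosh a * Real.cosh b ≤ Real.exp L * Real.exp L :=
    mul_le_mul (hcosh a ha) (hcosh b hb) (Real.cosh_pos b).le (Real.exp_pos L).le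
  calc Real.exp (-2 * L) * (b - a) * (Real.cosh a * Real.cosh b)
      ≤ Real.exp (-2 * L) * (b - a) * (Real.exp L * Real.exp L) := by
        gcongr
    _ = (b - a) * Real.exp (-2 * L + (L + L)) := by rw [Real.exp_add, Real.exp_add]; ring
    _ = b - a := by ring_nf; simp
    _ ≤ _ := hs

theorem spin_mono {a b : Bool} (h : a ≤ b) : spin a ≤ spin b := by
  revert h; cases a <;> cases b <;> simp [spin]

theorem spin_not (b : Bool) : spin (!b) = -spin b := by cases b <;> simp [spin]

theorem spin_inf_add_sup (a b : Bool) : spin (a ⊓ b) + spin (a ⊔ b) = spin a + spin b := by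
  cases a <;> cases b <;> simp [spin]

theorem spin_supermodular (a b c d : Bool) :
    spin a * spin c + spin b * spin d
      ≤ spin (a ⊓ b) * spin (c ⊓ d) + spin (a ⊔ b) * spin (c ⊔ d) := by
  cases a <;> cases b <;> cases c <;> cases d <;> norm_num [spin]

/-! ### The model restricted to a cell: correlation bounds and conditional independence -/

namespace SupervisedRBM

variable {n₁ n₂ : ℕ} (R : SupervisedRBM n₁ n₂)

/-- The field of the other units on the visible unit `u`. -/
def visField (u : Fin n₁) (h : Fin n₂ → Bool) : ℝ := R.b₁ u + ∑ j, R.W u j * spin (h j)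

/-- The field of the label and the visible units on the hidden unit `j`. -/
def hidField (y : Bool) (j : Fin n₂) (x : Fin n₁ → Bool) : ℝ :=
  R.b₂ j + spin y * R.w j + ∑ i, R.W i j * spin (x i)

theorem exponent_eq (x : Fin n₁ → Bool) (h : Fin n₂ → Bool) (y : Bool) :
    R.exponent (x, h, y) = ∑ i, ∑ j, R.W i j * (spin (x i) * spin (h j))
      + ∑ i, R.b₁ i * spin (x i) + ∑ j, (R.b₂ j + spin y * R.w j) * spin (h j)
      + R.b₃ * spin y := by
  unfold exponent spins
  simp only [dotProduct, Matrix.mulVec, Finset.mul_sum, Finset.sum_mul, add_mul,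
    Finset.sum_add_distrib]
  have e1 : ∀ i, ∀ j, spin (x i) * (R.W i j * spin (h j)) = R.W i j * (spin (x i) * spin (h j)) :=
    fun i j => by ring
  have e2 : ∀ j, spin (h j) * R.w j * spin y = spin y * R.w j * spin (h j) := fun j => by ring
  simp only [e1, e2]
  ring

theorem exponent_eq_visField (u : Fin n₁) (x : Fin n₁ → Bool) (h : Fin n₂ → Bool) (y : Bool) :
    R.exponent (x, h, y) = spin (x u) * R.visField u h
      + (∑ i ∈ Finset.univ.erase u, ∑ j, R.W i j * (spin (x i) * spin (h j))
      + ∑ i ∈ Finset.univ.erase u, R.b₁ i * spin (x i)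
      + ∑ j, (R.b₂ j + spin y * R.w j) * spin (h j) + R.b₃ * spin y) := by
  rw [exponent_eq, ← Finset.add_sum_erase _ _ (Finset.mem_univ u),
    ← Finset.add_sum_erase _ (fun i => R.b₁ i * spin (x i)) (Finset.mem_univ u), visField,
    mul_add, Finset.mul_sum]
  have e : ∀ j, R.W u j * (spin (x u) * spin (h j)) = spin (x u) * (R.W u j * spin (h j)) :=
    fun j => by ring
  simp only [e]
  ring

theorem exponent_eq_hidField (k : Fin n₂) (x : Fin n₁ → Bool) (h : Fin n₂ → Bool) (y : Bool) :
    R.exponent (x, h, y) = spin (h k) * R.hidField y k x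
      + (∑ j ∈ Finset.univ.erase k, ∑ i, R.W i j * (spin (x i) * spin (h j))
      + ∑ i, R.b₁ i * spin (x i)
      + ∑ j ∈ Finset.univ.erase k, (R.b₂ j + spin y * R.w j) * spin (h j) + R.b₃ * spin y) := by
  rw [exponent_eq, Finset.sum_comm, ← Finset.add_sum_erase _ _ (Finset.mem_univ k),
    ← Finset.add_sum_erase _ (fun j => (R.b₂ j + spin y * R.w j) * spin (h j))
      (Finset.mem_univ k), hidField, mul_add, Finset.mul_sum]
  have e : ∀ i, R.W i k * (spin (x i) * spin (h k)) = spin (h k) * (R.W i k * spin (x i)) :=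
    fun j => by ring
  simp only [e]
  ring

theorem exponent_flip_vis (u : Fin n₁) (x : Fin n₁ → Bool) (h : Fin n₂ → Bool) (y : Bool) :
    R.exponent (Function.update x u (!x u), h, y)
      = R.exponent (x, h, y) - 2 * spin (x u) * R.visField u h := by
  rw [R.exponent_eq_visField u, R.exponent_eq_visField u, Function.update_self, spin_not]
  have e : ∀ i ∈ Finset.univ.erase u, Function.update x u (!x u) i = x i := fun i hi =>
    Function.update_of_ne (Finset.ne_of_mem_erase hi) _ _
  rw [Finset.sum_congr rfl fun i hi => Finset.sum_congr rfl fun j _ => by rw [e i hi],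
    Finset.sum_congr (f := fun i => R.b₁ i * spin (Function.update x u (!x u) i)) rfl
      fun i hi => by rw [e i hi]]
  ring

theorem exponent_flip_hid (k : Fin n₂) (x : Fin n₁ → Bool) (h : Fin n₂ → Bool) (y : Bool) :
    R.exponent (x, Function.update h k (!h k), y)
      = R.exponent (x, h, y) - 2 * spin (h k) * R.hidField y k x := by
  rw [R.exponent_eq_hidField k, R.exponent_eq_hidField k, Function.update_self, spin_not]
  have e : ∀ i ∈ Finset.univ.erase k, Function.update h k (!h k) i = h i := fun i hi =>
    Function.update_of_ne (Finset.ne_of_mem_erase hi) _ _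
  rw [Finset.sum_congr rfl fun j hj => Finset.sum_congr rfl fun i _ => by rw [e j hj],
    Finset.sum_congr (f := fun j => (R.b₂ j + spin y * R.w j)
      * spin (Function.update h k (!h k) j)) rfl fun i hi => by rw [e i hi]]
  ring

/-- Linear terms are modular, and `spin_supermodular` handles each product since its weight is
nonnegative. The label is fixed, so the sign of `w` plays no role. -/
theorem exponent_supermodular (hW : ∀ i j, 0 ≤ R.W i j) (y : Bool)
    (a b : (Fin n₁ → Bool) × (Fin n₂ → Bool)) :
    R.exponent (a.1, a.2, y) + R.exponent (b.1, b.2, y)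
      ≤ R.exponent ((a ⊓ b).1, (a ⊓ b).2, y) + R.exponent ((a ⊔ b).1, (a ⊔ b).2, y) := by
  simp only [exponent_eq]
  have h1 : ∑ i, ∑ j, R.W i j * (spin (a.1 i) * spin (a.2 j))
      + ∑ i, ∑ j, R.W i j * (spin (b.1 i) * spin (b.2 j))
      ≤ ∑ i, ∑ j, R.W i j * (spin ((a ⊓ b).1 i) * spin ((a ⊓ b).2 j))
      + ∑ i, ∑ j, R.W i j * (spin ((a ⊔ b).1 i) * spin ((a ⊔ b).2 j)) := by
    simp only [← Finset.sum_add_distrib, ← mul_add]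
    refine Finset.sum_le_sum fun i _ => Finset.sum_le_sum fun j _ => ?_
    exact mul_le_mul_of_nonneg_left (spin_supermodular _ _ _ _) (hW i j)
  have h2 : ∑ i, R.b₁ i * spin ((a ⊓ b).1 i) + ∑ i, R.b₁ i * spin ((a ⊔ b).1 i)
      = ∑ i, R.b₁ i * spin (a.1 i) + ∑ i, R.b₁ i * spin (b.1 i) := by
    simp only [← Finset.sum_add_distrib, ← mul_add]
    exact Finset.sum_congr rfl fun i _ => congrArg _ (spin_inf_add_sup _ _)
  have h3 : ∑ j, (R.b₂ j + spin y * R.w j) * spin ((a ⊓ b).2 j)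
        + ∑ j, (R.b₂ j + spin y * R.w j) * spin ((a ⊔ b).2 j)
      = ∑ j, (R.b₂ j + spin y * R.w j) * spin (a.2 j)
        + ∑ j, (R.b₂ j + spin y * R.w j) * spin (b.2 j) := by
    simp only [← Finset.sum_add_distrib, ← mul_add]
    exact Finset.sum_congr rfl fun i _ => congrArg _ (spin_inf_add_sup _ _)
  linarith

/-- The weight of the visible and hidden units on the event that `X_S` is given by `A` and that the
label is `y`. -/
noncomputable def cellWeight (S A : Finset (Fin n₁)) (y : Bool)
    (c : (Fin n₁ → Bool) × (Fin n₂ → Bool)) : ℝ :=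
  if ∀ i ∈ S, c.1 i = decide (i ∈ A) then Real.exp (R.exponent (c.1, c.2, y)) else 0

variable {R}

theorem cellWeight_nonneg (S A : Finset (Fin n₁)) (y : Bool) : 0 ≤ R.cellWeight S A y := by
  intro c
  unfold cellWeight
  split_ifs
  · exact (Real.exp_pos _).le
  · exact le_rfl

theorem cellWeight_supermodular (hW : ∀ i j, 0 ≤ R.W i j) (S A : Finset (Fin n₁)) (y : Bool)
    (a b : (Fin n₁ → Bool) × (Fin n₂ → Bool)) :
    R.cellWeight S A y a * R.cellWeight S A y b
      ≤ R.cellWeight S A y (a ⊓ b) * R.cellWeight S A y (a ⊔ b) := by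
  by_cases ha : ∀ i ∈ S, a.1 i = decide (i ∈ A)
  · by_cases hb : ∀ i ∈ S, b.1 i = decide (i ∈ A)
    · have hi : ∀ i ∈ S, (a ⊓ b).1 i = decide (i ∈ A) := by
        intro i hi
        change a.1 i ⊓ b.1 i = _
        rw [ha i hi, hb i hi, inf_idem]
      have hs : ∀ i ∈ S, (a ⊔ b).1 i = decide (i ∈ A) := by
        intro i hi
        change a.1 i ⊔ b.1 i = _
        rw [ha i hi, hb i hi, sup_idem]
      unfold cellWeight
      rw [if_pos ha, if_pos hb, if_pos hi, if_pos hs, ← Real.exp_add, ← Real.exp_add]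
      exact Real.exp_le_exp.mpr (R.exponent_supermodular hW y a b)
    · have : R.cellWeight S A y b = 0 := if_neg hb
      rw [this, mul_zero]
      exact mul_nonneg (cellWeight_nonneg _ _ _ _) (cellWeight_nonneg _ _ _ _)
  · have : R.cellWeight S A y a = 0 := if_neg ha
    rw [this, zero_mul]
    exact mul_nonneg (cellWeight_nonneg _ _ _ _) (cellWeight_nonneg _ _ _ _)

theorem sum_cellWeight_pos (S A : Finset (Fin n₁)) (y : Bool) :
    0 < ∑ c, R.cellWeight S A y c := by
  refine Finset.sum_pos' (fun c _ => cellWeight_nonneg S A y c)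
    ⟨(fun i => decide (i ∈ A), fun _ => true), Finset.mem_univ _, ?_⟩
  unfold cellWeight
  rw [if_pos fun i _ => rfl]
  exact Real.exp_pos _

/-- Flipping a visible unit. -/
def flipVis (u : Fin n₁) :
    Equiv.Perm ((Fin n₁ → Bool) × (Fin n₂ → Bool)) :=
  Function.Involutive.toPerm (fun c => (Function.update c.1 u (!c.1 u), c.2)) (by
    intro c
    simp)

/-- Flipping a hidden unit. -/
def flipHid (k : Fin n₂) :
    Equiv.Perm ((Fin n₁ → Bool) × (Fin n₂ → Bool)) :=
  Function.Involutive.toPerm (fun c => (c.1, Function.update c.2 k (!c.2 k))) (by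
    intro c
    simp)

theorem flipVis_apply (u : Fin n₁) (c : (Fin n₁ → Bool) × (Fin n₂ → Bool)) :
    flipVis u c = (Function.update c.1 u (!c.1 u), c.2) := rfl

theorem flipHid_apply (k : Fin n₂) (c : (Fin n₁ → Bool) × (Fin n₂ → Bool)) :
    flipHid k c = (c.1, Function.update c.2 k (!c.2 k)) := rfl

theorem cellWeight_flipVis {u : Fin n₁} {S : Finset (Fin n₁)} (hu : u ∉ S) (A : Finset (Fin n₁))
    (y : Bool) (c : (Fin n₁ → Bool) × (Fin n₂ → Bool)) :
    R.cellWeight S A y (flipVis u c)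
      = R.cellWeight S A y c * Real.exp (-(2 * spin (c.1 u) * R.visField u c.2)) := by
  have h : (∀ i ∈ S, Function.update c.1 u (!c.1 u) i = decide (i ∈ A))
      ↔ ∀ i ∈ S, c.1 i = decide (i ∈ A) := by
    refine forall₂_congr fun i hi => ?_
    rw [Function.update_of_ne (ne_of_mem_of_not_mem hi hu)]
  unfold cellWeight
  simp only [flipVis_apply, h, exponent_flip_vis]
  split_ifs
  · rw [← Real.exp_add]; ring_nf
  · simp

theorem cellWeight_flipHid (k : Fin n₂) (S A : Finset (Fin n₁))
    (y : Bool) (c : (Fin n₁ → Bool) × (Fin n₂ → Bool)) :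
    R.cellWeight S A y (flipHid k c)
      = R.cellWeight S A y c * Real.exp (-(2 * spin (c.2 k) * R.hidField y k c.1)) := by
  unfold cellWeight
  simp only [flipHid_apply, exponent_flip_hid]
  split_ifs
  · rw [← Real.exp_add]; ring_nf
  · simp

/-- The conditional mean of `X_u` given everything else is `tanh` of its field. In terms of sums:
flipping `u` negates each summand of the difference. -/
theorem sum_cellWeight_spin {u : Fin n₁} {S : Finset (Fin n₁)} (hu : u ∉ S) (A : Finset (Fin n₁))
    (y : Bool) (φ : (Fin n₁ → Bool) × (Fin n₂ → Bool) → ℝ) (hφ : ∀ c, φ (flipVis u c) = φ c) :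
    ∑ c, R.cellWeight S A y c * (spin (c.1 u) * φ c)
      = ∑ c, R.cellWeight S A y c * (Real.tanh (R.visField u c.2) * φ c) := by
  rw [← sub_eq_zero, ← Finset.sum_sub_distrib]
  set f : (Fin n₁ → Bool) × (Fin n₂ → Bool) → ℝ := fun c =>
    R.cellWeight S A y c * (spin (c.1 u) * φ c)
      - R.cellWeight S A y c * (Real.tanh (R.visField u c.2) * φ c) with hf
  have h1 : ∑ c, f (flipVis u c) = ∑ c, f c := Equiv.sum_comp _ f
  have h2 : ∀ c, f (flipVis u c) = -f c := by
    intro c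
    simp only [hf, hφ, cellWeight_flipVis hu]
    simp only [flipVis_apply, Function.update_self, spin_not]
    have key : ∀ t F : ℝ, (t = 1 ∨ t = -1) →
        Real.exp (-(2 * t * F)) * (-t - Real.tanh F) = -(t - Real.tanh F) := by
      intro t F ht
      have hc := (Real.cosh_pos F).ne'
      have he : Real.exp (-F) * Real.exp F = 1 := by rw [← Real.exp_add]; simp
      rcases ht with rfl | rfl
      · have : Real.exp (-(2 * 1 * F)) = Real.exp (-F) * Real.exp (-F) := by
          rw [← Real.exp_add]; ring_nf
        rw [this, Real.tanh_eq_sinh_div_cosh]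
        field_simp
        rw [Real.sinh_eq, Real.cosh_eq]
        linear_combination (-(Real.exp (-F))) * he
      · have : Real.exp (-(2 * -1 * F)) = Real.exp F * Real.exp F := by
          rw [← Real.exp_add]; ring_nf
        rw [this, Real.tanh_eq_sinh_div_cosh]
        field_simp
        rw [Real.sinh_eq, Real.cosh_eq]
        linear_combination (Real.exp F) * he
    have := key (spin (c.1 u)) (R.visField u c.2) (by cases c.1 u <;> simp [spin])
    linear_combination (R.cellWeight S A y c * φ c) * this
  simp only [h2, Finset.sum_neg_distrib] at h1
  linarith

/-- The spins are averaged out one at a time: `X_v` is unaffected by flipping `u`, and the field on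
`u` depends only on hidden units, so it is unaffected by flipping `v`. -/
theorem wcov_spin_eq_wcov_tanh {u v : Fin n₁} {S : Finset (Fin n₁)} (hu : u ∉ S) (hv : v ∉ S)
    (huv : v ≠ u) (A : Finset (Fin n₁)) (y : Bool) :
    wcov (R.cellWeight S A y) (fun c => spin (c.1 u)) (fun c => spin (c.1 v))
      = wcov (R.cellWeight S A y) (fun c => Real.tanh (R.visField u c.2))
          (fun c => Real.tanh (R.visField v c.2)) := by
  unfold wcov
  have h1 := sum_cellWeight_spin (R := R) hu A y (fun c => spin (c.1 v)) (fun c => by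
    simp only [flipVis_apply]
    rw [Function.update_of_ne huv])
  have h2 := sum_cellWeight_spin (R := R) hv A y (fun c => Real.tanh (R.visField u c.2))
    (fun c => rfl)
  have h3 := sum_cellWeight_spin (R := R) hu A y (fun _ => 1) (fun c => rfl)
  have h4 := sum_cellWeight_spin (R := R) hv A y (fun _ => 1) (fun c => rfl)
  simp only [mul_one] at h3 h4
  rw [h1, h3, h4]
  congr 2
  have e1 : ∀ c : (Fin n₁ → Bool) × (Fin n₂ → Bool),
    Real.tanh (R.visField u c.2) * spin (c.1 v) = spin (c.1 v) * Real.tanh (R.visField u c.2) :=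
    fun c => mul_comm _ _
  have e2 : ∀ c : (Fin n₁ → Bool) × (Fin n₂ → Bool),
    Real.tanh (R.visField u c.2) * Real.tanh (R.visField v c.2)
      = Real.tanh (R.visField v c.2) * Real.tanh (R.visField u c.2) :=
    fun c => mul_comm _ _
  simp only [e1, e2]
  exact h2

theorem monotone_spin_vis (u : Fin n₁) :
    Monotone (fun c : (Fin n₁ → Bool) × (Fin n₂ → Bool) => spin (c.1 u)) :=
  fun _ _ h => spin_mono (h.1 u)

theorem monotone_spin_hid (k : Fin n₂) :
    Monotone (fun c : (Fin n₁ → Bool) × (Fin n₂ → Bool) => spin (c.2 k)) :=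
  fun _ _ h => spin_mono (h.2 k)

theorem wcov_spin_nonneg (hW : ∀ i j, 0 ≤ R.W i j) (u v : Fin n₁) (S A : Finset (Fin n₁))
    (y : Bool) :
    0 ≤ wcov (R.cellWeight S A y) (fun c => spin (c.1 u)) (fun c => spin (c.1 v)) :=
  wcov_nonneg (cellWeight_nonneg S A y) (monotone_spin_vis u) (monotone_spin_vis v)
    (cellWeight_supermodular hW S A y)

theorem abs_visField_le (hW : ∀ i j, 0 ≤ R.W i j) {lam : ℝ} {u : Fin n₁}
    (h : ∑ j, R.W u j + |R.b₁ u| ≤ lam) (x : Fin n₂ → Bool) : |R.visField u x| ≤ lam := by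
  refine le_trans ?_ h
  unfold visField
  refine (abs_add_le _ _).trans ?_
  rw [add_comm]
  gcongr
  refine (Finset.abs_sum_le_sum_abs _ _).trans (Finset.sum_le_sum fun j _ => ?_)
  rw [abs_mul, abs_spin, mul_one, abs_of_nonneg (hW u j)]

theorem abs_hidField_le (hW : ∀ i j, 0 ≤ R.W i j) {lam : ℝ} {y : Bool} {j : Fin n₂}
    (h : ∑ i, R.W i j + |R.b₂ j + spin y * R.w j| ≤ lam) (x : Fin n₁ → Bool) :
    |R.hidField y j x| ≤ lam := by
  refine le_trans ?_ h
  unfold hidField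
  refine (abs_add_le _ _).trans ?_
  rw [add_comm]
  gcongr
  refine (Finset.abs_sum_le_sum_abs _ _).trans (Finset.sum_le_sum fun i _ => ?_)
  rw [abs_mul, abs_spin, mul_one, abs_of_nonneg (hW i j)]

theorem monotone_tanh_visField_sub (hW : ∀ i j, 0 ≤ R.W i j) {lam α : ℝ} {u : Fin n₁}
    (h : ∑ j, R.W u j + |R.b₁ u| ≤ lam) {k : Fin n₂} (hk : α ≤ R.W u k) :
    Monotone (fun c : (Fin n₁ → Bool) × (Fin n₂ → Bool) =>
      Real.tanh (R.visField u c.2) - α * Real.exp (-2 * lam) * spin (c.2 k)) := by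
  intro c d hcd
  have hs : ∀ j, spin (c.2 j) ≤ spin (d.2 j) := fun j => spin_mono (hcd.2 j)
  have hF : α * (spin (d.2 k) - spin (c.2 k)) ≤ R.visField u d.2 - R.visField u c.2 := by
    have e : R.visField u d.2 - R.visField u c.2
        = ∑ j, R.W u j * (spin (d.2 j) - spin (c.2 j)) := by
      simp only [visField, mul_sub, Finset.sum_sub_distrib]
      ring
    rw [e]
    refine le_trans (mul_le_mul_of_nonneg_right hk (sub_nonneg.mpr (hs k))) ?_
    exact Finset.single_le_sum (f := fun j => R.W u j * (spin (d.2 j) - spin (c.2 j)))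
      (fun j _ => mul_nonneg (hW u j) (sub_nonneg.mpr (hs j))) (Finset.mem_univ k)
  have hle : R.visField u c.2 ≤ R.visField u d.2 := by
    unfold visField
    gcongr with j
    · exact hW u j
    · exact hs j
  have ht := tanh_sub_tanh_ge hle (abs_visField_le hW h c.2) (abs_visField_le hW h d.2)
  have := mul_le_mul_of_nonneg_left hF (Real.exp_pos (-2 * lam)).le
  simp only
  linarith

/-- Flipping a hidden unit stays in the cell and changes the weight by a factor of at least `exp (-2
* lam)`, so neither spin value can dominate. -/
theorem wcov_hid_self_ge (hW : ∀ i j, 0 ≤ R.W i j) {lam : ℝ} {y : Bool} {k : Fin n₂}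
    (h : ∑ i, R.W i k + |R.b₂ k + spin y * R.w k| ≤ lam) (S A : Finset (Fin n₁)) :
    Real.exp (-2 * lam) * (∑ c, R.cellWeight S A y c) ^ 2
      ≤ wcov (R.cellWeight S A y) (fun c => spin (c.2 k)) (fun c => spin (c.2 k)) := by
  have hflip : ∀ t : ℝ, |t| = 1 →
      Real.exp (-2 * lam) * ∑ c, R.cellWeight S A y c * (1 - t * spin (c.2 k))
        ≤ ∑ c, R.cellWeight S A y c * (1 + t * spin (c.2 k)) := by
    intro t ht
    rw [← Equiv.sum_comp (flipHid k) (fun c => R.cellWeight S A y c * (1 + t * spin (c.2 k))),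
      Finset.mul_sum]
    refine Finset.sum_le_sum fun c _ => ?_
    rw [cellWeight_flipHid]
    simp only [flipHid_apply, Function.update_self, spin_not]
    have h1 : Real.exp (-2 * lam) ≤ Real.exp (-(2 * spin (c.2 k) * R.hidField y k c.1)) := by
      apply Real.exp_le_exp.mpr
      have h2 := abs_hidField_le hW h c.1
      have h3 : |spin (c.2 k) * R.hidField y k c.1| ≤ lam := by rwa [abs_mul, abs_spin, one_mul]
      linarith [(abs_le.mp h3).2]
    have h4 : 0 ≤ R.cellWeight S A y c * (1 - t * spin (c.2 k)) := by
      refine mul_nonneg (cellWeight_nonneg S A y c) ?_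
      have : |t * spin (c.2 k)| ≤ 1 := by rw [abs_mul, ht, abs_spin, one_mul]
      linarith [(abs_le.mp this).2]
    have := mul_le_mul_of_nonneg_right h1 h4
    linarith
  have hp := hflip 1 (by simp)
  have hm := hflip (-1) (by simp)
  unfold wcov
  simp only [spin_mul_self, mul_one]
  simp only [mul_add, mul_sub, mul_one, Finset.sum_add_distrib, Finset.sum_sub_distrib, one_mul,
    neg_one_mul, mul_neg, Finset.sum_neg_distrib] at hp hm
  set P := ∑ c, R.cellWeight S A y c
  set H := ∑ c, R.cellWeight S A y c * spin (c.2 k)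
  set r := Real.exp (-2 * lam)
  have hr : 0 < r := Real.exp_pos _
  have hP : 0 < P := sum_cellWeight_pos S A y
  have hr1 : r * P ≤ P := by linarith
  -- The variance is `P² - H² = (P - |H|) (P + |H|)`, and the second factor is at least `P`.
  have h1 : r * P ≤ P - |H| := by
    rcases abs_cases H with ⟨e, e'⟩ | ⟨e, e'⟩ <;> rw [e] <;> nlinarith
  have := abs_mul_abs_self H
  nlinarith [abs_nonneg H, mul_nonneg hP.le (abs_nonneg H)]

theorem wcov_spin_ge (hW : ∀ i j, 0 ≤ R.W i j) {lam α : ℝ} (hα : 0 ≤ α) {y : Bool}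
    (hvis : ∀ i, ∑ j, R.W i j + |R.b₁ i| ≤ lam)
    (hhid : ∀ j, ∑ i, R.W i j + |R.b₂ j + spin y * R.w j| ≤ lam)
    {u v : Fin n₁} {k : Fin n₂} (hu : α ≤ R.W u k) (hv : α ≤ R.W v k) (huv : v ≠ u)
    {S : Finset (Fin n₁)} (huS : u ∉ S) (hvS : v ∉ S) (A : Finset (Fin n₁)) :
    α ^ 2 * Real.exp (-6 * lam) * (∑ c, R.cellWeight S A y c) ^ 2
      ≤ wcov (R.cellWeight S A y) (fun c => spin (c.1 u)) (fun c => spin (c.1 v)) := by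
  rw [wcov_spin_eq_wcov_tanh huS hvS huv]
  have hc : 0 ≤ α * Real.exp (-2 * lam) := by positivity
  have h1 := wcov_ge hc (cellWeight_nonneg S A y) (monotone_tanh_visField_sub hW (hvis u) hu)
    (monotone_tanh_visField_sub hW (hvis v) hv) (monotone_spin_hid k)
    (cellWeight_supermodular hW S A y)
  refine le_trans ?_ h1
  have h2 := mul_le_mul_of_nonneg_left (wcov_hid_self_ge hW (hhid k) S A)
    (sq_nonneg (α * Real.exp (-2 * lam)))
  refine le_trans (le_of_eq ?_) h2
  have : Real.exp (-6 * lam) = Real.exp (-2 * lam) ^ 2 * Real.exp (-2 * lam) := by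
    rw [← pow_succ, ← Real.exp_nat_mul]
    congr 1
    push_cast
    ring
  rw [this]
  ring

open Classical in
/-- Exchanging the visible unit `u` and its hidden neighbors between two configurations. -/
noncomputable def exchange (R : SupervisedRBM n₁ n₂) (u : Fin n₁) :
    Equiv.Perm (((Fin n₁ → Bool) × (Fin n₂ → Bool)) × ((Fin n₁ → Bool) × (Fin n₂ → Bool))) :=
  Function.Involutive.toPerm (fun p =>
    ((fun i => if i = u then p.2.1 i else p.1.1 i,
        fun j => if R.W u j = 0 then p.1.2 j else p.2.2 j),
      (fun i => if i = u then p.1.1 i else p.2.1 i,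
        fun j => if R.W u j = 0 then p.2.2 j else p.1.2 j)))
  (by
    rintro ⟨⟨x, h⟩, ⟨x', h'⟩⟩
    simp only [Prod.mk.injEq]
    refine ⟨⟨?_, ?_⟩, ?_, ?_⟩ <;> funext i <;> split_ifs <;> rfl)

open Classical in
theorem exchange_apply (R : SupervisedRBM n₁ n₂) (u : Fin n₁)
    (p : ((Fin n₁ → Bool) × (Fin n₂ → Bool)) × ((Fin n₁ → Bool) × (Fin n₂ → Bool))) :
    R.exchange u p =
      ((fun i => if i = u then p.2.1 i else p.1.1 i,
          fun j => if R.W u j = 0 then p.1.2 j else p.2.2 j),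
        (fun i => if i = u then p.1.1 i else p.2.1 i,
          fun j => if R.W u j = 0 then p.2.2 j else p.1.2 j)) :=
  rfl

theorem mem_twoHop {u v : Fin n₁} :
    v ∈ R.twoHop u ↔ v ≠ u ∧ ∃ j, R.W u j ≠ 0 ∧ R.W v j ≠ 0 := by
  unfold twoHop
  simp

/-- An interaction between an exchanged hidden unit and a visible unit `i ≠ u` forces `i` into the
two-hop neighborhood, hence into `S`. There both configurations have the same spin, so the total
exponent is unchanged. -/
theorem cellWeight_exchange {u : Fin n₁} {S : Finset (Fin n₁)} (hu : u ∉ S)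
    (hN : R.twoHop u ⊆ S) (A : Finset (Fin n₁)) (y : Bool)
    (p : ((Fin n₁ → Bool) × (Fin n₂ → Bool)) × ((Fin n₁ → Bool) × (Fin n₂ → Bool))) :
    R.cellWeight S A y (R.exchange u p).1 * R.cellWeight S A y (R.exchange u p).2
      = R.cellWeight S A y p.1 * R.cellWeight S A y p.2 := by
  classical
  obtain ⟨⟨x, h⟩, ⟨x', h'⟩⟩ := p
  have hS : ∀ z z' : Fin n₁ → Bool,
      (∀ i ∈ S, (if i = u then z' i else z i) = decide (i ∈ A))
        ↔ ∀ i ∈ S, z i = decide (i ∈ A) := by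
    intro z z'
    refine forall₂_congr fun i hi => ?_
    rw [if_neg (ne_of_mem_of_not_mem hi hu)]
  unfold cellWeight
  simp only [exchange_apply, hS]
  by_cases hx : ∀ i ∈ S, x i = decide (i ∈ A)
  swap
  · simp [if_neg hx]
  by_cases hx' : ∀ i ∈ S, x' i = decide (i ∈ A)
  swap
  · simp [if_neg hx']
  simp only [if_pos hx, if_pos hx', ← Real.exp_add]
  congr 1
  simp only [exponent_eq]
  have e1 : ∑ i, ∑ j, R.W i j * (spin (if i = u then x' i else x i)
          * spin (if R.W u j = 0 then h j else h' j))
        + ∑ i, ∑ j, R.W i j * (spin (if i = u then x i else x' i)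
          * spin (if R.W u j = 0 then h' j else h j))
      = ∑ i, ∑ j, R.W i j * (spin (x i) * spin (h j))
        + ∑ i, ∑ j, R.W i j * (spin (x' i) * spin (h' j)) := by
    simp only [← Finset.sum_add_distrib, ← mul_add]
    refine Finset.sum_congr rfl fun i _ => Finset.sum_congr rfl fun j _ => ?_
    by_cases hij : R.W i j = 0
    · simp [hij]
    congr 1
    by_cases hi : i = u
    · subst hi
      simp only [if_pos, if_neg hij]
      ring
    · simp only [if_neg hi]
      by_cases hj : R.W u j = 0
      · simp only [if_pos hj]
      · simp only [if_neg hj]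
        have hiS : i ∈ S := hN (mem_twoHop.mpr ⟨hi, j, hj, hij⟩)
        rw [hx i hiS, hx' i hiS]
        ring
  have e2 : ∑ i, R.b₁ i * spin (if i = u then x' i else x i)
        + ∑ i, R.b₁ i * spin (if i = u then x i else x' i)
      = ∑ i, R.b₁ i * spin (x i) + ∑ i, R.b₁ i * spin (x' i) := by
    simp only [← Finset.sum_add_distrib, ← mul_add]
    refine Finset.sum_congr rfl fun i _ => ?_
    split_ifs <;> ring
  have e3 : ∑ j, (R.b₂ j + spin y * R.w j) * spin (if R.W u j = 0 then h j else h' j)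
        + ∑ j, (R.b₂ j + spin y * R.w j) * spin (if R.W u j = 0 then h' j else h j)
      = ∑ j, (R.b₂ j + spin y * R.w j) * spin (h j)
        + ∑ j, (R.b₂ j + spin y * R.w j) * spin (h' j) := by
    simp only [← Finset.sum_add_distrib, ← mul_add]
    refine Finset.sum_congr rfl fun j _ => ?_
    split_ifs <;> ring
  linarith

theorem two_mul_wcov {α : Type*} [Fintype α] (μ f g : α → ℝ) :
    2 * wcov μ f g = ∑ p : α × α, μ p.1 * μ p.2 * ((f p.1 - f p.2) * (g p.1 - g p.2)) := by
  have e : ∀ a b : α, μ a * μ b * ((f a - f b) * (g a - g b))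
      = μ a * (f a * g a) * μ b + μ a * (μ b * (f b * g b))
        - μ a * f a * (μ b * g b) - μ a * g a * (μ b * f b) := fun a b => by ring
  simp only [Fintype.sum_prod_type, e, Finset.sum_add_distrib, Finset.sum_sub_distrib,
    ← Finset.mul_sum, ← Finset.sum_mul, wcov]
  ring

/-- In the two-replica formula for the covariance, the exchange preserves the weight and swaps the
two values of `X_u` but not those of `X_v`, so it reverses the sign. -/
theorem wcov_spin_eq_zero {u v : Fin n₁} {S : Finset (Fin n₁)} (hu : u ∉ S)
    (hN : R.twoHop u ⊆ S) (huv : v ≠ u) (A : Finset (Fin n₁)) (y : Bool) :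
    wcov (R.cellWeight S A y) (fun c => spin (c.1 u)) (fun c => spin (c.1 v)) = 0 := by
  have h := two_mul_wcov (R.cellWeight S A y) (fun c => spin (c.1 u)) (fun c => spin (c.1 v))
  have h2 := h
  rw [← Equiv.sum_comp (R.exchange u)] at h2
  simp only [cellWeight_exchange hu hN] at h2
  simp only [exchange_apply, if_true, if_neg huv] at h2
  have e : ∀ p : ((Fin n₁ → Bool) × (Fin n₂ → Bool)) × ((Fin n₁ → Bool) × (Fin n₂ → Bool)),
      R.cellWeight S A y p.1 * R.cellWeight S A y p.2
        * ((spin (p.2.1 u) - spin (p.1.1 u)) * (spin (p.1.1 v) - spin (p.2.1 v)))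
      = -(R.cellWeight S A y p.1 * R.cellWeight S A y p.2
        * ((spin (p.1.1 u) - spin (p.2.1 u)) * (spin (p.1.1 v) - spin (p.2.1 v)))) :=
    fun p => by ring
  simp only [e, Finset.sum_neg_distrib] at h2
  linarith

/-! ### The average conditional covariance of the model -/

/-- The expectation of a function of an observation. -/
noncomputable def popE (R : SupervisedRBM n₁ n₂) (f : Sample n₁ → ℝ) : ℝ :=
  ∑ c : Config n₁ n₂, R.prob c * f (c.1, c.2.2)

/-- The partition function. -/
noncomputable def partition (R : SupervisedRBM n₁ n₂) : ℝ :=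
  ∑ c : Config n₁ n₂, Real.exp (R.exponent c)

theorem partition_pos : 0 < R.partition :=
  Finset.sum_pos (fun _ _ => Real.exp_pos _) Finset.univ_nonempty

theorem popE_cellInd_mul (S A : Finset (Fin n₁)) (y : Bool) (f : (Fin n₁ → Bool) → ℝ) :
    R.popE (fun z => cellInd S A y z * f z.1)
      = (∑ c, R.cellWeight S A y c * f c.1) / R.partition := by
  unfold popE prob
  rw [← partition, Finset.sum_div]
  simp only [Fintype.sum_prod_type]
  refine Finset.sum_congr rfl fun x _ => Finset.sum_congr rfl fun h _ => ?_
  unfold cellInd cellWeight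
  rw [Fintype.sum_bool]
  by_cases hx : ∀ i ∈ S, x i = decide (i ∈ A)
  · rw [if_pos hx]
    cases y
    · rw [if_neg (fun h => Bool.false_ne_true h.2.symm), if_pos ⟨hx, rfl⟩]
      ring
    · rw [if_pos ⟨hx, rfl⟩, if_neg (fun h => Bool.false_ne_true h.2)]
      ring
  · simp only [hx, false_and, if_false]
    ring

theorem popE_cellInd (S A : Finset (Fin n₁)) (y : Bool) :
    R.popE (cellInd S A y) = (∑ c, R.cellWeight S A y c) / R.partition := by
  have := popE_cellInd_mul (R := R) S A y (fun _ => 1)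
  simpa using this

theorem covTerm_popE (u v : Fin n₁) (S A : Finset (Fin n₁)) (y : Bool) :
    covTerm R.popE u v S A y
      = wcov (R.cellWeight S A y) (fun c => spin (c.1 u)) (fun c => spin (c.1 v))
        / (∑ c, R.cellWeight S A y c) / R.partition := by
  unfold covTerm
  rw [popE_cellInd_mul S A y (fun x => spin (x u) * spin (x v)),
    popE_cellInd_mul S A y (fun x => spin (x u)), popE_cellInd_mul S A y (fun x => spin (x v)),
    popE_cellInd, wcov]
  have h1 := (partition_pos (R := R)).ne'
  have h2 := (sum_cellWeight_pos (R := R) S A y).ne'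
  field_simp

theorem covAvgOf_popE_eq_zero {u v : Fin n₁} {S : Finset (Fin n₁)} (hu : u ∉ S)
    (hN : R.twoHop u ⊆ S) (huv : v ≠ u) : covAvgOf R.popE u v S = 0 := by
  refine Finset.sum_eq_zero fun A _ => Finset.sum_eq_zero fun y _ => ?_
  rw [covTerm_popE, wcov_spin_eq_zero hu hN huv]
  simp

theorem law_real_label (y : Bool) :
    R.law.toMeasure.real {c | c.2.2 = y} = R.popE (fun z => if z.2 = y then 1 else 0) := by
  classical
  rw [MeasureTheory.measureReal_def, PMF.toMeasure_apply_fintype, ENNReal.toReal_sum]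
  · unfold popE
    refine Finset.sum_congr rfl fun c _ => ?_
    rw [Set.indicator_apply]
    simp only [Set.mem_ofPred_eq]
    split_ifs
    · simp [law, ENNReal.toReal_ofReal (R.prob_nonneg c)]
    · simp
  · intro c _
    rw [Set.indicator_apply]
    split_ifs
    · exact PMF.apply_ne_top _ _
    · simp

theorem sum_popE_cellInd (S : Finset (Fin n₁)) (y : Bool) :
    ∑ A ∈ S.powerset, R.popE (cellInd S A y) = R.popE (fun z => if z.2 = y then 1 else 0) := by
  unfold popE
  rw [Finset.sum_comm]
  refine Finset.sum_congr rfl fun c _ => ?_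
  rw [← Finset.mul_sum]
  congr 1
  by_cases hy : c.2.2 = y
  · simp only [if_pos hy]
    rw [← sum_powerset_ite_eq_one S c.1]
    refine Finset.sum_congr rfl fun A _ => ?_
    unfold cellInd
    simp [hy]
  · simp [cellInd, hy]

theorem covAvgOf_popE_ge {α lam β : ℝ} (hα : 0 < α) (hf : R.MinFerromagnetic α)
    (hs : R.CondSparse lam) (hb : R.BalancedLabel β) {u v : Fin n₁} (hv : v ∈ R.twoHop u)
    {S : Finset (Fin n₁)} (huS : u ∉ S) (hvS : v ∉ S) :
    β * (α ^ 2 * Real.exp (-6 * lam)) ≤ covAvgOf R.popE u v S := by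
  have hW : ∀ i j, 0 ≤ R.W i j := fun i j => by
    rcases hf i j with h | h
    · exact h.ge
    · exact hα.le.trans h
  obtain ⟨hvis, y, hhid⟩ := hs
  obtain ⟨huv, k, huk, hvk⟩ := mem_twoHop.mp hv
  have huk' := (hf u k).resolve_left huk
  have hvk' := (hf v k).resolve_left hvk
  have h1 : ∀ A, α ^ 2 * Real.exp (-6 * lam) * R.popE (cellInd S A y)
      ≤ ∑ y : Bool, covTerm R.popE u v S A y := by
    intro A
    -- Only the label with bounded hidden fields is kept; the other contributes a nonnegative amount
    -- by FKG.
    refine le_trans ?_ (Finset.single_le_sum (f := fun y => covTerm R.popE u v S A y)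
      (fun y _ => ?_) (Finset.mem_univ y))
    · rw [covTerm_popE, popE_cellInd, ← mul_div_assoc]
      have hZ := partition_pos (R := R)
      have hP := sum_cellWeight_pos (R := R) S A y
      gcongr
      rw [le_div_iff₀ hP, mul_assoc, ← sq]
      exact wcov_spin_ge hW hα.le hvis hhid huk' hvk' huv huS hvS A
    · rw [covTerm_popE]
      exact div_nonneg (div_nonneg (wcov_spin_nonneg hW u v S A y)
        (sum_cellWeight_pos S A y).le) partition_pos.le
  refine le_trans ?_ (Finset.sum_le_sum fun A _ => h1 A)
  rw [← Finset.mul_sum, sum_popE_cellInd, ← law_real_label, mul_comm]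
  exact mul_le_mul_of_nonneg_left (hb y) (by positivity)

end SupervisedRBM

/-! ### Stability under perturbed moments, and concentration -/

open MeasureTheory ProbabilityTheory

theorem abs_mul_div_sub_mul_div_le {a b p a' b' p' ε : ℝ} (hb : |b| ≤ p)
    (ha' : |a'| ≤ p') (hda : |a - a'| ≤ ε) (hdb : |b - b'| ≤ ε)
    (hdp : |p - p'| ≤ ε) : |a * b / p - a' * b' / p'| ≤ 3 * ε := by
  have hr : ∀ x q : ℝ, |x| ≤ q → ∃ t, |t| ≤ 1 ∧ x = t * q ∧ ∀ z, z * x / q = z * t := by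
    intro x q hx
    have hq : 0 ≤ q := (abs_nonneg x).trans hx
    rcases hq.eq_or_lt with h0 | h0
    · subst h0
      exact ⟨0, by simp, by simpa using hx, by simp⟩
    · refine ⟨x / q, ?_, by field_simp, fun z => by ring⟩
      rw [abs_div, abs_of_pos h0]
      exact (div_le_one h0).mpr hx
  obtain ⟨t, ht, htb, htz⟩ := hr b p hb
  obtain ⟨r, hr1, hra, hrz⟩ := hr a' p' ha'
  rw [htz, mul_comm a' b', hrz]
  -- With `t = b / p` and `r = a' / p'` in `[-1, 1]`, no denominator remains; each of the three
  -- terms is at most `ε`.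
  have e : a * t - b' * r = (a - a') * t + r * ((p' - p) * t) + r * (b - b') := by
    rw [hra, htb]; ring
  have hε : 0 ≤ ε := (abs_nonneg _).trans hda
  have h1 : |(a - a') * t| ≤ ε := by
    rw [abs_mul]; exact (mul_le_mul hda ht (abs_nonneg _) hε).trans_eq (mul_one _)
  have h2 : |r * ((p' - p) * t)| ≤ ε := by
    rw [abs_mul, abs_mul, abs_sub_comm]
    have := mul_le_mul hdp ht (abs_nonneg _) hε
    exact (mul_le_mul hr1 this (by positivity) zero_le_one).trans_eq (by ring)
  have h3 : |r * (b - b')| ≤ ε := by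
    rw [abs_mul]; exact (mul_le_mul hr1 hdb (abs_nonneg _) zero_le_one).trans_eq (one_mul _)
  rw [e]
  refine (abs_add_three _ _ _).trans ?_
  linarith

/-- The functions of an observation whose expectations determine a term of the average conditional
covariance. -/
noncomputable def momentFn {n : ℕ} (u : Fin n)
    (i : (Finset (Fin n) × Finset (Fin n)) × Bool × Fin n × Bool × Bool) (z : Sample n) : ℝ :=
  cellInd i.1.1 i.1.2 i.2.1 z * ((if i.2.2.2.1 then spin (z.1 u) else 1)
    * (if i.2.2.2.2 then spin (z.1 i.2.2.1) else 1))

theorem abs_momentFn_le {n : ℕ} (u : Fin n)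
    (i : (Finset (Fin n) × Finset (Fin n)) × Bool × Fin n × Bool × Bool) (z : Sample n) :
    |momentFn u i z| ≤ 1 := by
  unfold momentFn
  have h1 : |if i.2.2.2.1 then spin (z.1 u) else 1| = 1 := by
    split_ifs
    · exact abs_spin _
    · exact abs_one
  have h2 : |if i.2.2.2.2 then spin (z.1 i.2.2.1) else 1| = 1 := by
    split_ifs
    · exact abs_spin _
    · exact abs_one
  rw [abs_mul, abs_mul, h1, h2, abs_of_nonneg (cellInd_nonneg _ _ _ _), mul_one, mul_one]
  exact cellInd_le_one _ _ _ _

/-- The pairs of a set of at most `K` visible units and a subset, with the remaining data of a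
moment. -/
def momentIndex (n K : ℕ) :
    Finset ((Finset (Fin n) × Finset (Fin n)) × Bool × Fin n × Bool × Bool) :=
  ((Finset.univ.filter fun S : Finset (Fin n) => S.card ≤ K)
    ×ˢ (Finset.univ.filter fun S : Finset (Fin n) => S.card ≤ K)) ×ˢ Finset.univ

theorem card_filter_card_le {n : ℕ} (hn : 2 ≤ n) (K : ℕ) :
    (Finset.univ.filter fun S : Finset (Fin n) => S.card ≤ K).card ≤ n ^ (K + 1) := by
  have h1 : (Finset.univ.filter fun S : Finset (Fin n) => S.card ≤ K)
      ⊆ (Finset.range (K + 1)).biUnion fun k => Finset.powersetCard k Finset.univ := by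
    intro S hS
    simp only [Finset.mem_filter, Finset.mem_univ, true_and] at hS
    simp only [Finset.mem_biUnion, Finset.mem_range, Finset.mem_powersetCard, Finset.subset_univ,
      true_and, exists_eq_right']
    omega
  refine (Finset.card_le_card h1).trans (Finset.card_biUnion_le.trans ?_)
  refine le_trans (Finset.sum_le_sum fun k _ => ?_)
    (Nat.geomSum_lt hn (s := Finset.range (K + 1)) (fun k hk => Finset.mem_range.mp hk)).le
  rw [Finset.card_powersetCard, Finset.card_univ, Fintype.card_fin]
  exact Nat.choose_le_pow n k

/-- The leading `2` accounts for the two tails in Hoeffding's inequality; `2 ≤ n` absorbs the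
constant `2 ^ 4` into a power of `n`. -/
theorem card_momentIndex_le {n : ℕ} (hn : 2 ≤ n) (K : ℕ) :
    2 * (momentIndex n K).card ≤ n ^ (2 * K + 7) := by
  have h := card_filter_card_le hn K
  unfold momentIndex
  rw [Finset.card_product, Finset.card_product, Finset.card_univ]
  simp only [Fintype.card_prod, Fintype.card_bool, Fintype.card_fin]
  calc _ ≤ 2 * (n ^ (K + 1) * n ^ (K + 1) * (2 * (n * (2 * 2)))) := by gcongr
    _ = 2 ^ 4 * (n ^ (2 * K + 2) * n) := by ring
    _ ≤ n ^ 4 * (n ^ (2 * K + 2) * n) := by gcongr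
    _ = n ^ (2 * K + 7) := by ring

namespace SupervisedRBM

variable {n n₂ m : ℕ} (R : SupervisedRBM n n₂)

theorem integral_sampleLaw (f : Sample n → ℝ) : ∫ z, f z ∂(R.sampleLaw.toMeasure) = R.popE f := by
  unfold sampleLaw
  rw [← PMF.toMeasure_map _ _ (measurable_of_finite _),
    integral_map (measurable_of_finite _).aemeasurable
      (measurable_of_finite f).aestronglyMeasurable, PMF.integral_eq_sum]
  unfold popE
  refine Finset.sum_congr rfl fun c _ => ?_
  simp [law, ENNReal.toReal_ofReal (R.prob_nonneg c)]

instance : IsProbabilityMeasure (R.samplesLaw m) := by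
  unfold samplesLaw
  infer_instance

theorem measure_sum_sub_ge_le {f : Sample n → ℝ} (hf : ∀ z, |f z| ≤ 1) {t : ℝ} (ht : 0 ≤ t) :
    (R.samplesLaw m).real {s | t ≤ ∑ k, (f (s k) - R.popE f)} ≤ Real.exp (-t ^ 2 / (2 * m)) := by
  have hind : iIndepFun (fun (k : Fin m) (s : Fin m → Sample n) => f (s k) - R.popE f)
      (R.samplesLaw m) :=
    iIndepFun_pi (X := fun _ z => f z - R.popE f) fun _ => (measurable_of_finite _).aemeasurable
  have hsub : ∀ k ∈ (Finset.univ : Finset (Fin m)),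
      HasSubgaussianMGF (fun s : Fin m → Sample n => f (s k) - R.popE f) 1 (R.samplesLaw m) := by
    intro k _
    -- The sub-Gaussian parameter is the squared half-length of `[-1, 1]`, which is `1`.
    have h := hasSubgaussianMGF_of_mem_Icc (μ := R.samplesLaw m) (a := -1) (b := 1)
      (X := fun s : Fin m → Sample n => f (s k)) (measurable_of_finite _).aemeasurable
      (Filter.Eventually.of_forall fun s => abs_le.mp (hf (s k)))
    have hint : ∫ s, f (s k) ∂(R.samplesLaw m) = R.popE f := by
      rw [← integral_sampleLaw]
      exact integral_comp_eval (μ := fun _ : Fin m => R.sampleLaw.toMeasure)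
        (measurable_of_finite f).aestronglyMeasurable
    rw [hint] at h
    convert h using 1
    norm_num
  have h := HasSubgaussianMGF.measure_sum_ge_le_of_iIndepFun hind hsub ht
  simpa using h

theorem measure_abs_empE_sub_ge_le (hm : 0 < m) {f : Sample n → ℝ} (hf : ∀ z, |f z| ≤ 1) {ε : ℝ}
    (hε : 0 ≤ ε) :
    (R.samplesLaw m).real {s | ε ≤ |empE s f - R.popE f|} ≤ 2 * Real.exp (-(m * ε ^ 2 / 2)) := by
  have hm' : (0 : ℝ) < m := by exact_mod_cast hm
  have h1 := R.measure_sum_sub_ge_le (m := m) hf (t := m * ε) (by positivity)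
  have h2 := R.measure_sum_sub_ge_le (m := m) (f := fun z => -f z) (fun z => by
    rw [abs_neg]; exact hf z) (t := m * ε) (by positivity)
  have e : -(m * ε) ^ 2 / (2 * m) = -(m * ε ^ 2 / 2) := by field_simp
  rw [e] at h1 h2
  have hsub : {s : Fin m → Sample n | ε ≤ |empE s f - R.popE f|}
      ⊆ {s | m * ε ≤ ∑ k, (f (s k) - R.popE f)}
        ∪ {s | m * ε ≤ ∑ k, (-f (s k) - R.popE (fun z => -f z))} := by
    intro s hs
    have hs' : ε ≤ |empE s f - R.popE f| := hs
    have hp : R.popE (fun z => -f z) = -R.popE f := by simp [popE]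
    have he : ∑ k, f (s k) = m * empE s f := by unfold empE; field_simp
    change m * ε ≤ ∑ k, (f (s k) - R.popE f) ∨ m * ε ≤ ∑ k, (-f (s k) - R.popE fun z => -f z)
    simp only [Finset.sum_sub_distrib, Finset.sum_neg_distrib, hp, he, Finset.sum_const,
      Finset.card_univ, Fintype.card_fin, nsmul_eq_mul]
    rcases le_abs.mp hs' with h | h
    · left; nlinarith
    · right; nlinarith
  refine (measureReal_mono hsub).trans ((measureReal_union_le _ _).trans ?_)
  linarith

theorem popE_abs_le {f g : Sample n → ℝ} (h : ∀ z, |f z| ≤ g z) : |R.popE f| ≤ R.popE g := by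
  unfold popE
  refine (Finset.abs_sum_le_sum_abs _ _).trans (Finset.sum_le_sum fun c _ => ?_)
  rw [abs_mul, abs_of_nonneg (R.prob_nonneg c)]
  exact mul_le_mul_of_nonneg_left (h _) (R.prob_nonneg c)

theorem abs_empCovAvg_sub_le {s : Fin m → Sample n} {u : Fin n} {K : ℕ} {ε : ℝ}
    (h : ∀ i ∈ momentIndex n K, |empE s (momentFn u i) - R.popE (momentFn u i)| ≤ ε) (v : Fin n)
    {S : Finset (Fin n)} (hS : S.card ≤ K) :
    |GreedyNbhd.empCovAvg s u v S - covAvgOf R.popE u v S| ≤ 8 * 2 ^ K * ε := by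
  have hmem : ∀ A ⊆ S, ∀ q : Bool × Fin n × Bool × Bool, ((S, A), q) ∈ momentIndex n K := by
    intro A hA q
    simp only [momentIndex, Finset.mem_product, Finset.mem_filter, Finset.mem_univ, true_and,
      and_true]
    exact ⟨hS, (Finset.card_le_card hA).trans hS⟩
  have hε : 0 ≤ ε := (abs_nonneg _).trans (h _ (hmem ∅ (by simp) (true, u, true, true)))
  -- The mixed moment contributes `ε` and the quotient `3 * ε`; two labels and at most `2 ^ K` sign
  -- patterns then give `8 * 2 ^ K * ε`.
  have hterm : ∀ A ∈ S.powerset, ∀ y : Bool,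
      |covTerm (empE s) u v S A y - covTerm R.popE u v S A y| ≤ 4 * ε := by
    intro A hA y
    rw [Finset.mem_powerset] at hA
    have h11 := h _ (hmem A hA (y, v, true, true))
    have h10 := h _ (hmem A hA (y, v, true, false))
    have h01 := h _ (hmem A hA (y, v, false, true))
    have h00 := h _ (hmem A hA (y, v, false, false))
    have e : ∀ i, momentFn u i = fun z => cellInd i.1.1 i.1.2 i.2.1 z
        * ((if i.2.2.2.1 then spin (z.1 u) else 1)
          * (if i.2.2.2.2 then spin (z.1 i.2.2.1) else 1)) := fun _ => rfl
    simp only [e, if_true, Bool.false_eq_true, if_false, mul_one, one_mul] at h11 h10 h01 h00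
    have hq := abs_mul_div_sub_mul_div_le
      (empE_abs_le s fun z => abs_cellInd_mul_spin S A y z v)
      (R.popE_abs_le fun z => abs_cellInd_mul_spin S A y z u) h10 h01 h00
    unfold covTerm
    rw [sub_sub_sub_comm]
    refine (abs_sub _ _).trans ?_
    linarith
  rw [empCovAvg_eq]
  unfold covAvgOf
  simp only [← Finset.sum_sub_distrib]
  calc _ ≤ ∑ A ∈ S.powerset, ∑ y : Bool, 4 * ε := by
        refine (Finset.abs_sum_le_sum_abs _ _).trans (Finset.sum_le_sum fun A hA => ?_)
        exact (Finset.abs_sum_le_sum_abs _ _).trans (Finset.sum_le_sum fun y _ => hterm A hA y)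
    _ = 8 * 2 ^ S.card * ε := by
        simp only [Finset.sum_const, Finset.card_powerset, Finset.card_univ, Fintype.card_bool,
          nsmul_eq_mul]
        push_cast
        ring
    _ ≤ 8 * 2 ^ K * ε := by
        gcongr
        norm_num

theorem one_sub_le_measure_moments (hm : 0 < m) (hn : 2 ≤ n) (u : Fin n) (K : ℕ) {ε ζ : ℝ}
    (hε : 0 ≤ ε) (hζ : 0 < ζ)
    (h : Real.log (1 / ζ) + (2 * K + 7) * Real.log n ≤ m * ε ^ 2 / 2) :
    1 - ζ ≤ (R.samplesLaw m).real
      {s | ∀ i ∈ momentIndex n K, |empE s (momentFn u i) - R.popE (momentFn u i)| ≤ ε} := by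
  have hn0 : (0 : ℝ) < n := by exact_mod_cast (by omega : 0 < n)
  set bad : Set (Fin m → Sample n) := ⋃ i ∈ momentIndex n K,
    {s | ε ≤ |empE s (momentFn u i) - R.popE (momentFn u i)|} with hbad
  have h1 : (R.samplesLaw m).real bad ≤ ζ := by
    refine (measureReal_biUnion_finset_le _ _).trans ?_
    refine (Finset.sum_le_sum fun i _ =>
      R.measure_abs_empE_sub_ge_le hm (abs_momentFn_le u i) hε).trans ?_
    rw [Finset.sum_const, nsmul_eq_mul]
    have hc : (2 : ℝ) * (momentIndex n K).card ≤ (n : ℝ) ^ (2 * K + 7) := by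
      exact_mod_cast card_momentIndex_le hn K
    calc ((momentIndex n K).card : ℝ) * (2 * Real.exp (-(m * ε ^ 2 / 2)))
        = (2 * (momentIndex n K).card) * Real.exp (-(m * ε ^ 2 / 2)) := by ring
      _ ≤ (n : ℝ) ^ (2 * K + 7) * Real.exp (-(m * ε ^ 2 / 2)) := by gcongr
      _ = Real.exp ((2 * K + 7) * Real.log n - m * ε ^ 2 / 2) := by
          have e : (2 * K + 7) * Real.log n = Real.log ((n : ℝ) ^ (2 * K + 7)) := by
            rw [Real.log_pow]
            push_cast
            ring
          rw [sub_eq_add_neg, Real.exp_add, e, Real.exp_log (by positivity)]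
      _ ≤ Real.exp (-Real.log (1 / ζ)) := Real.exp_le_exp.mpr (by linarith)
      _ = ζ := by rw [one_div, Real.log_inv, neg_neg, Real.exp_log hζ]
  have h2 : badᶜ ⊆ {s | ∀ i ∈ momentIndex n K,
      |empE s (momentFn u i) - R.popE (momentFn u i)| ≤ ε} := by
    intro s hs i hi
    by_contra hlt
    exact hs (Set.mem_biUnion hi (not_le.mp hlt).le)
  have h3 := measureReal_mono (μ := R.samplesLaw m) h2
  rw [probReal_compl_eq_one_sub (Set.toFinite bad).measurableSet] at h3
  linarith

end SupervisedRBM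

/-! ### Assembling the theorem -/

namespace GreedyNbhd

theorem isOutput_iff_of_estimates {n m : ℕ} {s : Fin m → Sample n} {u : Fin n} {τ κ : ℝ}
    {N : Finset (Fin n)} (hτ : 0 < τ) (hm : 0 < m) (hκ : 1 / τ ^ 2 ≤ κ) (huN : u ∉ N)
    (hlow : ∀ S : Finset (Fin n), S.card ≤ κ → u ∉ S → ∀ v ∈ N, v ∉ S → τ ≤ empCovAvg s u v S)
    (hupp : ∀ S : Finset (Fin n), S.card ≤ κ → u ∉ S → ∀ v, v ≠ u → v ∉ S → N ⊆ S →
      empCovAvg s u v S < τ) (T : Finset (Fin n)) : IsOutput s u τ T ↔ T = N := by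
  refine ⟨fun h => h.eq_of_estimates hτ hκ huN hlow hupp, ?_⟩
  rintro rfl
  -- The converse needs some output to exist; the implementation supplies one.
  have h := (run_spec s u hτ hm).1
  rwa [h.eq_of_estimates hτ hκ huN hlow hupp] at h

end GreedyNbhd

namespace SupervisedRBM

variable {n n₂ : ℕ} {R : SupervisedRBM n n₂}

theorem CondSparse.le_lam {α lam : ℝ} (hα : 0 < α) (hf : R.MinFerromagnetic α)
    (hs : R.CondSparse lam) (u : Fin n) (j : Fin n₂) (hj : R.W u j ≠ 0) : α ≤ lam := by
  have h1 := (hf u j).resolve_left hj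
  have h2 := Finset.single_le_sum (f := fun j => R.W u j) (fun j _ => by
    rcases hf u j with h | h
    · exact h.ge
    · exact hα.le.trans h) (Finset.mem_univ j)
  have h3 := hs.1 u
  have h4 := abs_nonneg (R.b₁ u)
  linarith

theorem CondSparse.lam_nonneg {α lam : ℝ} (hα : 0 < α) (hf : R.MinFerromagnetic α)
    (hs : R.CondSparse lam) (u : Fin n) : 0 ≤ lam := by
  refine le_trans ?_ (hs.1 u)
  refine add_nonneg (Finset.sum_nonneg fun j _ => ?_) (abs_nonneg _)
  rcases hf u j with h | h
  · exact h.ge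
  · exact hα.le.trans h

theorem BalancedLabel.le_one {β : ℝ} (hb : R.BalancedLabel β) : β ≤ 1 :=
  (hb true).trans measureReal_le_one

/-- Together with `α ≤ lam` and `β ≤ 1`, this shows that `τ ≤ 1 / 2` as soon as `u` has a hidden
neighbor. -/
theorem sq_mul_exp_le_one {x : ℝ} (hx : 0 ≤ x) : x ^ 2 * Real.exp (-12 * x) ≤ 1 := by
  have h1 : x ≤ Real.exp (6 * x) := by linarith [Real.add_one_le_exp (6 * x)]
  have h2 : Real.exp (-12 * x) * Real.exp (6 * x) ^ 2 = 1 := by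
    rw [← Real.exp_nat_mul, ← Real.exp_add, Real.exp_eq_one_iff]
    push_cast
    ring
  rw [← h2, mul_comm]
  gcongr

theorem isOutput_iff_of_moments {m K : ℕ} {s : Fin m → Sample n} {u : Fin n} {α lam β τ : ℝ}
    (hm : 0 < m) (hα : 0 < α) (hβ : 0 < β) (hf : R.MinFerromagnetic α) (hs : R.CondSparse lam)
    (hb : R.BalancedLabel β) (hτ : τ = β * α ^ 2 / 2 * Real.exp (-12 * lam))
    (hK : K = ⌊1 / τ ^ 2⌋₊)
    (h : ∀ i ∈ momentIndex n K,
      |empE s (momentFn u i) - R.popE (momentFn u i)| ≤ τ / (16 * 2 ^ K))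
    (T : Finset (Fin n)) : GreedyNbhd.IsOutput s u τ T ↔ T = R.twoHop u := by
  have hτ0 : 0 < τ := by rw [hτ]; positivity
  have hcard : ∀ S : Finset (Fin n), (S.card : ℝ) ≤ 1 / τ ^ 2 → S.card ≤ K := by
    intro S hS
    rw [hK]
    exact Nat.le_floor hS
  have hdiff : ∀ (v : Fin n) (S : Finset (Fin n)), (S.card : ℝ) ≤ 1 / τ ^ 2 →
      |GreedyNbhd.empCovAvg s u v S - covAvgOf R.popE u v S| ≤ τ / 2 := by
    -- The accuracy `τ / (16 * 2 ^ K)` is chosen so that `8 * 2 ^ K` times it is `τ / 2`.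
    intro v S hS
    refine (R.abs_empCovAvg_sub_le h v (hcard S hS)).trans_eq ?_
    field_simp
    norm_num
  have huN : u ∉ R.twoHop u := fun h => (mem_twoHop.mp h).1 rfl
  refine GreedyNbhd.isOutput_iff_of_estimates hτ0 hm le_rfl huN ?_ ?_ T
  · intro S hS huS v hv hvS
    have h1 := covAvgOf_popE_ge hα hf hs hb hv huS hvS
    have h2 : Real.exp (-12 * lam) ≤ Real.exp (-6 * lam) :=
      Real.exp_le_exp.mpr (by linarith [hs.lam_nonneg hα hf u])
    have h3 : 2 * τ ≤ β * (α ^ 2 * Real.exp (-6 * lam)) := by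
      rw [hτ]
      have := mul_le_mul_of_nonneg_left h2 (by positivity : 0 ≤ β * α ^ 2)
      linarith
    have h4 := (abs_le.mp (hdiff v S hS)).1
    linarith
  · intro S hS huS v hvu _ hN
    have h1 := covAvgOf_popE_eq_zero huS hN hvu
    have h4 := (abs_le.mp (hdiff v S hS)).2
    linarith

/-- These cases escape the union bound (`n < 2`) or the sample-size estimate (`1 < τ`). In both the
neighborhood is empty and the greedy phase stops at once, the second because covariances are at most
`1`. -/
theorem isOutput_iff_of_trivial {m : ℕ} (s : Fin m → Sample n) {u : Fin n} {α lam β τ : ℝ}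
    (hm : 0 < m) (hα : 0 < α) (hβ : 0 < β) (hf : R.MinFerromagnetic α) (hs : R.CondSparse lam)
    (hb : R.BalancedLabel β) (hτ : τ = β * α ^ 2 / 2 * Real.exp (-12 * lam))
    (h : n < 2 ∨ 1 < τ)
    (T : Finset (Fin n)) : GreedyNbhd.IsOutput s u τ T ↔ T = R.twoHop u := by
  have hτ0 : 0 < τ := by rw [hτ]; positivity
  have huN : u ∉ R.twoHop u := fun h => (mem_twoHop.mp h).1 rfl
  have hN : ∀ v, v ∉ R.twoHop u := by
    intro v hv
    obtain ⟨hvu, j, hj, -⟩ := mem_twoHop.mp hv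
    rcases h with h | h
    · exact hvu (Fin.ext (by omega))
    · have h1 := hs.le_lam hα hf u j hj
      have h2 := sq_mul_exp_le_one (hs.lam_nonneg hα hf u)
      have h3 := hb.le_one
      have h4 : α ^ 2 * Real.exp (-12 * lam) ≤ 1 := by
        refine le_trans ?_ h2
        gcongr
      have h5 : β * (α ^ 2 * Real.exp (-12 * lam)) ≤ 1 :=
        mul_le_one₀ h3 (by positivity) h4
      rw [hτ] at h
      linarith
  refine GreedyNbhd.isOutput_iff_of_estimates hτ0 hm le_rfl huN
    (fun S _ _ v hv => absurd hv (hN v)) ?_ T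
  intro S _ _ v hvu _ _
  rcases h with h | h
  · exact absurd (Fin.ext (by omega)) hvu
  · exact (empCovAvg_le_one s u v S).trans_lt h

end SupervisedRBM

/-- The factor `1024 = 4 * 16 ^ 2` leaves `2 * (L + 8 q l)` with `q = 1 / τ ^ 2`; since `K ≤ q` and
`1 ≤ q`, the term `(2 * K + 7) * l` fits into `16 * q * l`. -/
theorem sample_size_bound {τ β δ L M l : ℝ} {K : ℕ} (hτ : 0 < τ) (hτ1 : τ ≤ 1) (hβ : 0 < β)
    (hβ1 : β ≤ 1) (hδ : 0 < δ) (hδ1 : δ ≤ 1) (hL : 0 ≤ L) (hl : 0 ≤ l) (hK : K ≤ 1 / τ ^ 2)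
    (hM : 1024 * ((L + 8 / τ ^ 2 * l) * ((2 : ℝ) ^ (2 * (8 / τ ^ 2))
      / (τ ^ 2 * β * δ ^ (2 * (8 / τ ^ 2))))) ≤ M) :
    L + (2 * K + 7) * l ≤ M * (τ / (16 * 2 ^ K)) ^ 2 / 2 := by
  have h1 : 1 ≤ 1 / τ ^ 2 := by
    rw [le_div_iff₀ (by positivity), one_mul]
    exact pow_le_one₀ hτ.le hτ1
  set q := 1 / τ ^ 2 with hq
  have hT : 8 / τ ^ 2 = 8 * q := by rw [hq]; ring
  rw [hT] at hM
  have h2 : ((2 : ℝ) ^ K) ^ 2 ≤ (2 : ℝ) ^ (2 * (8 * q)) := by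
    rw [← pow_mul, ← Real.rpow_natCast]
    apply Real.rpow_le_rpow_of_exponent_le one_le_two
    push_cast
    linarith
  have h3 : δ ^ (2 * (8 * q)) ≤ 1 := Real.rpow_le_one hδ.le hδ1 (by linarith)
  have h4 : β * δ ^ (2 * (8 * q)) ≤ 1 := mul_le_one₀ hβ1 (by positivity) h3
  have h5 : ((2 : ℝ) ^ K) ^ 2 / τ ^ 2
      ≤ (2 : ℝ) ^ (2 * (8 * q)) / (τ ^ 2 * β * δ ^ (2 * (8 * q))) := by
    have : τ ^ 2 * β * δ ^ (2 * (8 * q)) ≤ τ ^ 2 := by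
      rw [mul_assoc]
      exact mul_le_of_le_one_right (by positivity) h4
    gcongr
  have h6 : 0 ≤ L + 8 * q * l := by positivity
  have h7 : 1024 * ((L + 8 * q * l) * (((2 : ℝ) ^ K) ^ 2 / τ ^ 2)) ≤ M := by
    refine le_trans ?_ hM
    gcongr
  have h8 : 2 * (L + 8 * q * l) ≤ M * (τ / (16 * 2 ^ K)) ^ 2 / 2 := by
    have h9 := mul_le_mul_of_nonneg_right h7
      (by positivity : 0 ≤ (τ / (16 * 2 ^ K)) ^ 2 / 2)
    have e : 1024 * ((L + 8 * q * l) * (((2 : ℝ) ^ K) ^ 2 / τ ^ 2)) * ((τ / (16 * 2 ^ K)) ^ 2 / 2)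
        = 2 * (L + 8 * q * l) := by
      field_simp
      ring
    rw [e] at h9
    linarith
  have h10 : (2 * K + 7) * l ≤ 16 * q * l := by
    gcongr
    linarith
  linarith

theorem mainTheorem11 :
    ∃ C c : ℝ, 0 < C ∧ 0 < c ∧
      ∀ (n n₂ m : ℕ) (R : SupervisedRBM n n₂) (u : Fin n) (α lam β ζ τ δ Tstar : ℝ),
        0 < α → 0 < β → 0 < ζ → ζ < 1 →
        R.MinFerromagnetic α → R.CondSparse lam → R.BalancedLabel β →
        τ = β * α ^ 2 / 2 * Real.exp (-12 * lam) →
        δ = Real.exp (-2 * lam) / 2 →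
        Tstar = 8 / τ ^ 2 →
        C * ((Real.log (1 / ζ) + Tstar * Real.log n) *
          ((2 : ℝ) ^ (2 * Tstar) / (τ ^ 2 * β * δ ^ (2 * Tstar)))) ≤ m →
        1 - ζ ≤ (R.samplesLaw m).real
            {s | ∀ T : Finset (Fin n), GreedyNbhd.IsOutput s u τ T ↔ T = R.twoHop u} ∧
        ∀ s : Fin m → Sample n,
          GreedyNbhd.IsOutput s u τ (GreedyNbhd.run s u τ).val.toFinset ∧
          ((GreedyNbhd.run s u τ).time : ℝ) ≤ c * (max 1 Tstar * m * n) := by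
  refine ⟨1024, 400, by norm_num, by norm_num, ?_⟩
  intro n n₂ m R u α lam β ζ τ δ Tstar hα hβ hζ hζ1 hf hs hb hτ hδ hT hm
  have hτ0 : 0 < τ := by rw [hτ]; positivity
  have hδ0 : 0 < δ := by rw [hδ]; positivity
  have hL : 0 < Real.log (1 / ζ) := Real.log_pos (by rw [lt_div_iff₀ hζ]; linarith)
  have hlog : 0 ≤ Real.log n := Real.log_natCast_nonneg n
  -- `ζ < 1` makes `log (1 / ζ)` positive, so the sample-size condition excludes `m = 0`.
  have hm0 : 0 < m := by
    have : (0 : ℝ) < m := lt_of_lt_of_le (by subst hT; positivity) hm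
    exact_mod_cast this
  subst hT
  refine ⟨?_, fun s => GreedyNbhd.run_spec s u hτ0 hm0⟩
  by_cases htriv : n < 2 ∨ 1 < τ
  · have : {s : Fin m → Sample n | ∀ T : Finset (Fin n),
        GreedyNbhd.IsOutput s u τ T ↔ T = R.twoHop u} = Set.univ :=
      Set.eq_univ_of_forall fun s T =>
        SupervisedRBM.isOutput_iff_of_trivial s hm0 hα hβ hf hs hb hτ htriv T
    rw [this, probReal_univ]
    linarith
  · push Not at htriv
    have hδ1 : δ ≤ 1 := by
      have : Real.exp (-2 * lam) ≤ 1 :=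
        Real.exp_le_one_iff.mpr (by linarith [hs.lam_nonneg hα hf u])
      rw [hδ]
      linarith
    have hKle : (⌊1 / τ ^ 2⌋₊ : ℝ) ≤ 1 / τ ^ 2 := Nat.floor_le (by positivity)
    have hbound := sample_size_bound hτ0 htriv.2 hβ hb.le_one hδ0 hδ1 hL.le hlog hKle hm
    refine (R.one_sub_le_measure_moments hm0 htriv.1 u _ (by positivity) hζ hbound).trans ?_
    exact measureReal_mono fun s h T =>
      SupervisedRBM.isOutput_iff_of_moments hm0 hα hβ hf hs hb hτ rfl h T
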